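/- Let $n\ge 1$ and let $g:[0,\infty)\to[0,\infty)$ be a complete Bernstein function, i.e. $g(x)=a+bx+\int_0^\infty(1-e^{-xt})\,m(t)\,dt$ with $a,b\ge 0$, $\int_0^\infty(1\wedge t)\,m(t)\,dt<\infty$ and $m$ the Laplace transform of a positive measure on $[0,\infty)$. Assume that $g$ is not identically zero on $(0,\infty)$ and that $g(|y|^{-2})|y|^{-n}\,dy$ is a Lévy measure on $\mathbb R^n$, i.e. $\int_{\mathbb R^n}(1\wedge|y|^2)\,g(|y|^{-2})\,|y|^{-n}\,dy<\infty$. Put $$\psi_\infty(\xi)=\int_{\mathbb R^n}\bigl(1-\cos(\xi\cdot y)\bigr)\,g\Bigl(\frac1{|y|^2}\Bigr)\frac{dy}{|y|^n},\qquad \mu(t)=\int_0^t\int_r^\infty\frac{g(s)}{s^2}\,ds\,dr .$$ Then there are constants $c,\gamma>0$, depending only on $n$ and $g$, such that the following holds. Let $X=(X_t)_{t\ge 0}$ be a Lévy process in $\mathbb R^n$ with symbol $\psi(\xi)=\psi_\infty(\xi)$ or $\psi(\xi)=\mu(|\xi|^2)$, i.e. $\mathbb E e^{i\xi\cdot X_t}=e^{-t\psi(\xi)}$.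 Then $X$ has a transition density: for every $t>0$ the law of $X_t$ has a density $p_t$ with respect to Lebesgue measure, and these densities can be chosen such that $$p_t(x)\le c\,\Bigl[g^{-1}\Bigl(\frac1{\gamma t}\Bigr)\Bigr]^{n/2}\qquad\text{for all }0<t<\infty,\ x\in\mathbb R^n.$$ Here $g^{-1}(u)=\inf\{s\ge0: g(s)\ge u\}$ with $\inf\emptyset=\infty$; this is the ordinary inverse of $g$ on the range of $g$, and $g^{-1}(u)=\infty$ (no bound is claimed) if $u$ is not below $\sup g$. -/

import Mathlib

open MeasureTheory ProbabilityTheory Set Filter Topology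
open scoped NNReal ENNReal

/-- `f`, restricted to `[0,∞)`, is the Bernstein function
`f x = a + b x + ∫_{(0,∞)} (1 - e^{-x t}) ρ(dt)` with `a, b ≥ 0` and a measure `ρ` on `(0,∞)`
such that `∫ (1 ∧ t) ρ(dt) < ∞`. The values of `f` on `(-∞,0)` play no role. -/
structure HasBernsteinRepr (f : ℝ → ℝ) (a b : ℝ) (ρ : Measure ℝ) : Prop where
  a_nonneg : 0 ≤ a
  b_nonneg : 0 ≤ b
  support : ρ (Iic 0) = 0
  lintegral_lt_top : ∫⁻ t, ENNReal.ofReal (min 1 t) ∂ρ < ∞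
  eq_integral : ∀ x, 0 ≤ x → f x = a + b * x + ∫ t, (1 - Real.exp (-(x * t))) ∂ρ

/-- The Laplace transform `t ↦ ∫_{[0,∞)} e^{-t s} σ(ds)` of a positive measure `σ` on `[0,∞)`. -/
noncomputable def laplaceTransform (σ : Measure ℝ≥0) (t : ℝ) : ℝ≥0∞ :=
  ∫⁻ s, ENNReal.ofReal (Real.exp (-(t * s))) ∂σ

/-- `f` is a complete Bernstein function: a Bernstein function whose representing measure has
a density on `(0,∞)` which is the (finite) Laplace transform of a positive measure on `[0,∞)`. -/
def IsCompleteBernstein (f : ℝ → ℝ) : Prop :=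
  ∃ (a b : ℝ) (σ : Measure ℝ≥0),
    (∀ t, 0 < t → laplaceTransform σ t < ∞) ∧
    HasBernsteinRepr f a b ((volume.restrict (Ioi 0)).withDensity (laplaceTransform σ))

/-- The inverse of an increasing function `g` on `[0,∞)`, with value `∞` at the levels that
`g` does not reach: `g⁻¹(u) = inf {s ≥ 0 : g s ≥ u}`, where `inf ∅ = ∞`. -/
noncomputable def genInv (g : ℝ → ℝ) (u : ℝ) : ℝ≥0∞ :=
  sInf {r : ℝ≥0∞ | ∃ s : ℝ, 0 ≤ s ∧ u ≤ g s ∧ r = ENNReal.ofReal s}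

/-- The jump density `y ↦ g(|y|⁻²) |y|⁻ⁿ` on `ℝⁿ`. -/
noncomputable def jumpDensity {n : ℕ} (g : ℝ → ℝ) (y : EuclideanSpace ℝ (Fin n)) : ℝ :=
  g (1 / ‖y‖ ^ 2) / ‖y‖ ^ n

/-- The symbol `ψ_∞(ξ) = ∫ (1 - cos (ξ·y)) g(|y|⁻²) |y|⁻ⁿ dy`. -/
noncomputable def psiInfty {n : ℕ} (g : ℝ → ℝ) (ξ : EuclideanSpace ℝ (Fin n)) : ℝ :=
  ∫ y : EuclideanSpace ℝ (Fin n), (1 - Real.cos (inner ℝ ξ y)) * jumpDensity g y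

/-- The function `μ(t) = ∫_0^t ∫_r^∞ g(s) s⁻² ds dr`. -/
noncomputable def muFun (g : ℝ → ℝ) (t : ℝ) : ℝ :=
  ∫ r in (0 : ℝ)..t, ∫ s in Ioi r, g s / s ^ 2

/-- `X` is a Lévy process in `ℝⁿ` under `P`, started at `0`: stationary and independent
increments, stochastically continuous. -/
structure IsLevyProcess {n : ℕ} {Ω : Type*} [MeasurableSpace Ω] (P : Measure Ω)
    (X : ℝ≥0 → Ω → EuclideanSpace ℝ (Fin n)) : Prop where
  measurable : ∀ t, Measurable (X t)
  start_zero : ∀ᵐ ω ∂P, X 0 ω = 0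
  indep_increments : HasIndepIncrements X P
  stationary_increments : ∀ s t, P.map (fun ω => X (s + t) ω - X s ω) = P.map (X t)
  stochastically_continuous : ∀ t, TendstoInMeasure P X (𝓝 t) (X t)

/-- `X` has the (real-valued) symbol `ψ`: `E e^{i ξ·X_t} = e^{-t ψ(ξ)}`. -/
def HasSymbol {n : ℕ} {Ω : Type*} [MeasurableSpace Ω] (P : Measure Ω)
    (X : ℝ≥0 → Ω → EuclideanSpace ℝ (Fin n)) (ψ : EuclideanSpace ℝ (Fin n) → ℝ) : Prop :=
  ∀ t ξ, charFun (P.map (X t)) ξ = ((Real.exp (-((t : ℝ) * ψ ξ)) : ℝ) : ℂ)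

/-- `p t` is, for every `t > 0`, a Lebesgue density of the law of `X_t`; then `p t (y - x)` is
the density of the transition from `x` to `y` in time `t`. -/
def IsTransitionDensity {n : ℕ} {Ω : Type*} [MeasurableSpace Ω] (P : Measure Ω)
    (X : ℝ≥0 → Ω → EuclideanSpace ℝ (Fin n))
    (p : ℝ≥0 → EuclideanSpace ℝ (Fin n) → ℝ) : Prop :=
  ∀ t, 0 < t → Measurable (p t) ∧ (∀ x, 0 ≤ p t x) ∧
    P.map (X t) = volume.withDensity (fun x => ENNReal.ofReal (p t x))

/-! Everything rests on one logarithmic lower bound: both symbols satisfy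
$\psi(\xi)\ge\kappa\,g(s)\log(|\xi|^2/s)$ whenever $0<s\le|\xi|^2$. If $t\kappa g(s)\ge n$, then
$e^{-t\psi(\xi)}\le(|\xi|^2/s)^{-n}$ for $|\xi|^2\ge s$. So the characteristic function is
integrable, its integral scales like $s^{n/2}$, and Fourier inversion bounds the density by a
multiple of $s^{n/2}$ (`measure_le_of_symbol_lower_bound`). With $\gamma=\kappa/n$ the condition
reads $g(s)\ge 1/(\gamma t)$; letting $s$ decrease to $g^{-1}(1/(\gamma t))$ gives the claim.

For $\psi_\infty$ the bound comes from dyadic annuli (`exists_psiInfty_lower_bound`). The measure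
$|y|^{-n}dy$ is scale invariant, so each annulus of outer radius at least $1/|\xi|$ contributes a
fixed amount to $\int(1-\cos(\xi\cdot y))|y|^{-n}dy$. About $\log(|\xi|^2/s)$ such annuli fit inside
$|y|<s^{-1/2}$, where $g(|y|^{-2})\ge g(s)$. For $\mu$, exchanging integrals gives
$\mu(u)=\int_0^\infty g(x)x^{-2}\min(x,u)\,dx\ge g(s)\int_s^u dx/x$ (`muENN_lower_bound`).

When $1/(\gamma t)$ is not reached by $g$, $e^{-t\psi}$ need not be integrable, yet a density must
still exist. It does because the Lévy measure is absolutely continuous and of infinite mass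
(`absolutelyContinuous_of_charFun`): each truncation splits off a compound Poisson factor whose
singular part has mass only $e^{-|\nu_k|}$. The mass is infinite because a finite one would make the
symbol bounded. For $\mu(|\xi|^2)$ the Lévy density is obtained by subordination: $g(s)/s^2$ is the
Laplace transform of an explicit weight $w$, hence $\mu(u)=\int_0^\infty(1-e^{-xu})x^{-2}w(x)\,dx$,
and the Lévy density is the corresponding mixture of heat kernels. -/

/-! ### Compound Poisson laws and absolute continuity -/

section CompoundPoisson

variable {E : Type*} [NormedAddCommGroup E] [InnerProductSpace ℝ E] [MeasurableSpace E]
  [BorelSpace E] [FiniteDimensional ℝ E]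

/-- The `k`-fold convolution power of a measure. -/
noncomputable def convPow (ν : Measure E) : ℕ → Measure E
  | 0 => Measure.dirac 0
  | k + 1 => (convPow ν k).conv ν

instance isFiniteMeasure_convPow (ν : Measure E) [IsFiniteMeasure ν] (k : ℕ) :
    IsFiniteMeasure (convPow ν k) := by
  induction k with
  | zero => unfold convPow; infer_instance
  | succ k ih => unfold convPow; infer_instance

lemma charFun_convPow (ν : Measure E) [IsFiniteMeasure ν] (k : ℕ) (ξ : E) :
    charFun (convPow ν k) ξ = charFun ν ξ ^ k := by
  induction k with
  | zero => simp [convPow]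
  | succ k ih => rw [convPow, charFun_conv, ih, pow_succ]

lemma convPow_univ (ν : Measure E) [IsFiniteMeasure ν] (k : ℕ) :
    convPow ν k univ = ENNReal.ofReal (ν.real univ ^ k) := by
  have h := charFun_convPow ν k 0
  rw [charFun_zero, charFun_zero] at h
  have h' : (convPow ν k).real univ = ν.real univ ^ k := by exact_mod_cast h
  rw [← h', ofReal_measureReal]

/-- The weights of the Poisson law with parameter the total mass of `ν`, with the normalization
of `ν` moved in front. -/
noncomputable def poissonWeight (ν : Measure E) (k : ℕ) : ℝ :=
  Real.exp (-ν.real univ) / (k.factorial : ℝ)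

omit [NormedAddCommGroup E] [InnerProductSpace ℝ E] [BorelSpace E] [FiniteDimensional ℝ E] in
lemma poissonWeight_nonneg (ν : Measure E) (k : ℕ) : 0 ≤ poissonWeight ν k := by
  unfold poissonWeight; positivity

/-- The compound Poisson law `e^{-|ν|} ∑ ν^{*k} / k!` with finite Lévy measure `ν`. -/
noncomputable def compoundPoisson (ν : Measure E) : Measure E :=
  Measure.sum fun k => ENNReal.ofReal (poissonWeight ν k) • convPow ν k

/-- The part of the compound Poisson law coming from at least one jump. -/
noncomputable def compoundPoissonJump (ν : Measure E) : Measure E :=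
  Measure.sum fun k => ENNReal.ofReal (poissonWeight ν (k + 1)) • convPow ν (k + 1)

instance isProbabilityMeasure_compoundPoisson (ν : Measure E) [IsFiniteMeasure ν] :
    IsProbabilityMeasure (compoundPoisson ν) := by
  constructor
  rw [compoundPoisson, Measure.sum_apply _ MeasurableSet.univ]
  have h := hasSum_one_poissonMeasure (ν.real univ).toNNReal
  rw [Real.coe_toNNReal _ measureReal_nonneg] at h
  have h2 : ∀ k, (ENNReal.ofReal (poissonWeight ν k) • convPow ν k) univ =
      ENNReal.ofReal (Real.exp (-ν.real univ) * ν.real univ ^ k / (k.factorial : ℝ)) := by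
    intro k
    rw [Measure.smul_apply, smul_eq_mul, convPow_univ,
      ← ENNReal.ofReal_mul (poissonWeight_nonneg ν k), poissonWeight]
    congr 1; ring
  simp_rw [h2]
  rw [← ENNReal.ofReal_tsum_of_nonneg (fun k => by positivity) h.summable, h.tsum_eq]
  simp

/-- Convolution powers become powers of the characteristic function, so the defining sum is an
exponential series. -/
lemma charFun_compoundPoisson (ν : Measure E) [IsFiniteMeasure ν] (ξ : E) :
    charFun (compoundPoisson ν) ξ = Complex.exp (charFun ν ξ - (ν.real univ : ℂ)) := by
  have hint : Integrable (fun x => Complex.exp (inner ℝ x ξ * Complex.I)) (compoundPoisson ν) := by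
    refine Integrable.of_bound (C := 1) (by fun_prop) (ae_of_all _ fun x => ?_)
    rw [Complex.norm_exp_ofReal_mul_I]
  have h1 := hasSum_integral_measure hint
  have h2 : ∀ k, ∫ x, Complex.exp (inner ℝ x ξ * Complex.I)
      ∂(ENNReal.ofReal (poissonWeight ν k) • convPow ν k) =
      Complex.exp (-(ν.real univ : ℂ)) * (charFun ν ξ ^ k / (k.factorial : ℂ)) := by
    intro k
    rw [integral_smul_measure, ENNReal.toReal_ofReal (poissonWeight_nonneg ν k), ← charFun_apply,
      charFun_convPow, poissonWeight, Complex.real_smul]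
    push_cast
    ring
  simp_rw [h2] at h1
  have h3 := (NormedSpace.expSeries_div_hasSum_exp (charFun ν ξ)).mul_left
    (Complex.exp (-(ν.real univ : ℂ)))
  rw [charFun_apply]
  change ∫ x, Complex.exp (inner ℝ x ξ * Complex.I) ∂(compoundPoisson ν) = _
  rw [compoundPoisson, h1.unique h3, ← Complex.exp_eq_exp_ℂ, ← Complex.exp_add]
  congr 1; ring

omit [InnerProductSpace ℝ E] [BorelSpace E] [FiniteDimensional ℝ E] in
-- Only the term without jumps, an atom at the origin of mass $e^{-|\nu|}$, can be singular.
lemma compoundPoisson_apply_le (ν : Measure E) [IsFiniteMeasure ν] {A : Set E}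
    (hA : MeasurableSet A) :
    compoundPoisson ν A ≤ ENNReal.ofReal (Real.exp (-ν.real univ)) + compoundPoissonJump ν A := by
  rw [compoundPoisson, compoundPoissonJump, Measure.sum_apply _ hA, Measure.sum_apply _ hA,
    tsum_eq_zero_add' (f := fun k => (ENNReal.ofReal (poissonWeight ν k) • convPow ν k) A)
      ENNReal.summable]
  refine add_le_add_left ?_ _
  rw [Measure.smul_apply, smul_eq_mul]
  calc _ ≤ ENNReal.ofReal (poissonWeight ν 0) * 1 := by
        gcongr; unfold convPow; exact prob_le_one
    _ = _ := by simp [poissonWeight]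

omit [InnerProductSpace ℝ E] [BorelSpace E] [FiniteDimensional ℝ E] in
lemma compoundPoissonJump_le (ν : Measure E) : compoundPoissonJump ν ≤ compoundPoisson ν := by
  refine Measure.le_iff.2 fun A hA => ?_
  rw [compoundPoisson, compoundPoissonJump, Measure.sum_apply _ hA, Measure.sum_apply _ hA]
  exact ENNReal.tsum_comp_le_tsum_of_injective (add_left_injective 1)
    fun k => (ENNReal.ofReal (poissonWeight ν k) • convPow ν k) A

lemma compoundPoissonJump_absolutelyContinuous {ν : Measure E} [IsFiniteMeasure ν]
    (hν : ν ≪ volume) : compoundPoissonJump ν ≪ volume :=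
  Measure.absolutelyContinuous_sum_left fun _ =>
    Measure.AbsolutelyContinuous.smul_left (Measure.conv_absolutelyContinuous hν) _

/-- A finite measure with a density is small on sets of small volume. -/
lemma exists_forall_le_of_absolutelyContinuous {R : Measure E} [IsFiniteMeasure R]
    (hR : R ≪ volume) {ε : ℝ≥0∞} (hε : ε ≠ 0) :
    ∃ δ > 0, ∀ B : Set E, volume B < δ → R B ≤ ε := by
  have hd := Measure.withDensity_rnDeriv_eq R volume hR
  obtain ⟨δ, hδ, h⟩ := exists_pos_setLIntegral_lt_of_measure_lt
    (μ := volume) (f := R.rnDeriv volume) (Measure.lintegral_rnDeriv_lt_top R volume).ne hε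
  refine ⟨δ, hδ, fun B hB => ?_⟩
  have := h B hB
  rw [← withDensity_apply' _ B, hd] at this
  exact this.le

/-- Translates of a set have the same volume, so smallness on sets of small volume survives
averaging over translations. The bound does not depend on `Q`, which later allows a limit in `Q`. -/
lemma conv_apply_le_of_forall_le {Q R : Measure E} [IsProbabilityMeasure Q] [IsFiniteMeasure R]
    {δ ε : ℝ≥0∞} (hR : ∀ B, MeasurableSet B → volume B < δ → R B ≤ ε) {A : Set E}
    (hA : MeasurableSet A) (hAδ : volume A < δ) : (Q.conv R) A ≤ ε := by
  rw [← lintegral_indicator_one hA,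
    Measure.lintegral_conv (measurable_one.indicator hA)]
  calc _ ≤ ∫⁻ _, ε ∂Q := by
        refine lintegral_mono fun x => ?_
        have : ∀ y, A.indicator (1 : E → ℝ≥0∞) (x + y) =
            ((fun y => x + y) ⁻¹' A).indicator (1 : E → ℝ≥0∞) y := fun y => rfl
        simp_rw [this]
        have hm : MeasurableSet ((fun y => x + y) ⁻¹' A) := (measurable_const_add x) hA
        rw [lintegral_indicator_one hm]
        exact hR _ hm (by rwa [measure_preimage_add])
    _ = ε := by simp

omit [FiniteDimensional ℝ E] in
-- Symmetry makes the characteristic function real, leaving only the cosine part. The lower integral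
-- on the right is the form that extends to infinite Lévy measures.
lemma charFun_sub_eq_of_symm {ν : Measure E} [IsFiniteMeasure ν]
    (hν : ν.map (fun y => -y) = ν) (ξ : E) :
    charFun ν ξ - (ν.real univ : ℂ) =
      ((-(∫⁻ y, ENNReal.ofReal (1 - Real.cos (inner ℝ ξ y)) ∂ν).toReal : ℝ) : ℂ) := by
  have hre : (starRingEnd ℂ) (charFun ν ξ) = charFun ν ξ := by
    have h := charFun_map_smul (μ := ν) (-1) ξ
    simp only [neg_smul, one_smul, hν] at h
    rw [h, charFun_neg, Complex.conj_conj, ← charFun_neg, ← h]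
  have hint : Integrable (fun x => Complex.exp (inner ℝ x ξ * Complex.I)) ν := by
    refine Integrable.of_bound (C := 1) (by fun_prop) (ae_of_all _ fun x => ?_)
    rw [Complex.norm_exp_ofReal_mul_I]
  have hcos : (charFun ν ξ).re = ∫ y, Real.cos (inner ℝ ξ y) ∂ν := by
    rw [charFun_apply]
    have := integral_re hint
    simp only [RCLike.re_to_complex] at this
    rw [← this]
    congr 1; ext y
    rw [Complex.exp_ofReal_mul_I_re, real_inner_comm]
  have hi : Integrable (fun y => Real.cos (inner ℝ ξ y)) ν :=
    Integrable.of_bound (C := 1) (by fun_prop) (ae_of_all _ fun x => Real.abs_cos_le_one _)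
  rw [← integral_eq_lintegral_of_nonneg_ae
    (ae_of_all _ fun y => sub_nonneg.2 (Real.cos_le_one _)) (by fun_prop),
    integral_sub (integrable_const _) hi, ← hcos, ← Complex.conj_eq_iff_re.1 hre]
  simp

lemma map_neg_withDensity {f : E → ℝ≥0∞} (hf : ∀ y, f (-y) = f y) :
    ((volume : Measure E).withDensity f).map (fun y => -y) = volume.withDensity f := by
  ext A hA
  rw [Measure.map_apply measurable_neg hA, withDensity_apply _ (measurable_neg hA),
    withDensity_apply _ hA]
  have := (Measure.measurePreserving_neg (volume : Measure E)).setLIntegral_comp_preimage_emb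
    (MeasurableEquiv.neg E).measurableEmbedding f A
  simp_rw [hf] at this
  exact this

lemma charFun_compoundPoisson_withDensity {f : E → ℝ≥0∞} (hfm : Measurable f)
    (hf : ∀ y, f (-y) = f y) [IsFiniteMeasure ((volume : Measure E).withDensity f)] (ξ : E) :
    charFun (compoundPoisson (volume.withDensity f)) ξ = ((Real.exp
      (-(∫⁻ y, ENNReal.ofReal (1 - Real.cos (inner ℝ ξ y)) * f y).toReal) : ℝ) : ℂ) := by
  rw [charFun_compoundPoisson, charFun_sub_eq_of_symm (map_neg_withDensity hf), Complex.ofReal_exp,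
    lintegral_withDensity_eq_lintegral_mul _ hfm (by fun_prop)]
  congr 5
  ext y
  simp [mul_comm]

/-- Truncation of a jump density, with finite total mass. -/
noncomputable def truncDensity (j : E → ℝ≥0∞) (k : ℕ) (y : E) : ℝ≥0∞ :=
  (Metric.closedBall 0 (k : ℝ)).indicator (fun y => min (j y) k) y

omit [MeasurableSpace E] [BorelSpace E] [InnerProductSpace ℝ E] [FiniteDimensional ℝ E] in
lemma truncDensity_neg {j : E → ℝ≥0∞} (hj : ∀ y, j (-y) = j y) (k : ℕ) (y : E) :
    truncDensity j k (-y) = truncDensity j k y := by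
  simp [truncDensity, indicator, hj]

omit [InnerProductSpace ℝ E] [FiniteDimensional ℝ E] in
lemma measurable_truncDensity {j : E → ℝ≥0∞} (hj : Measurable j) (k : ℕ) :
    Measurable (truncDensity j k) :=
  (hj.min measurable_const).indicator Metric.isClosed_closedBall.measurableSet

omit [MeasurableSpace E] [BorelSpace E] [InnerProductSpace ℝ E] [FiniteDimensional ℝ E] in
lemma truncDensity_mono (j : E → ℝ≥0∞) (y : E) : Monotone fun k => truncDensity j k y := by
  intro k l hkl
  have h : (k : ℝ≥0∞) ≤ l := by exact_mod_cast hkl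
  refine (indicator_le_indicator_of_subset (Metric.closedBall_subset_closedBall
    (by exact_mod_cast hkl)) (fun _ => zero_le) y).trans (indicator_le_indicator ?_)
  exact min_le_min le_rfl h

omit [MeasurableSpace E] [BorelSpace E] [InnerProductSpace ℝ E] [FiniteDimensional ℝ E] in
lemma tendsto_truncDensity (j : E → ℝ≥0∞) (y : E) :
    Tendsto (fun k => truncDensity j k y) atTop (𝓝 (j y)) := by
  have h : Tendsto (fun k : ℕ => min (j y) (k : ℝ≥0∞)) atTop (𝓝 (min (j y) ⊤)) :=
    tendsto_const_nhds.min ENNReal.tendsto_nat_nhds_top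
  rw [min_top_right] at h
  refine h.congr' ?_
  obtain ⟨N, hN⟩ := exists_nat_ge ‖y‖
  filter_upwards [eventually_ge_atTop N] with k hk
  rw [truncDensity, indicator_of_mem]
  simpa using hN.trans (by exact_mod_cast hk)

lemma lintegral_truncDensity_lt_top (j : E → ℝ≥0∞) (k : ℕ) :
    ∫⁻ y, truncDensity j k y < ∞ := by
  calc _ ≤ ∫⁻ y, (Metric.closedBall 0 (k : ℝ)).indicator (fun _ : E => (k : ℝ≥0∞)) y :=
        lintegral_mono fun y => indicator_le_indicator (min_le_right _ _)
    _ = k * volume (Metric.closedBall (0 : E) (k : ℝ)) :=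
        lintegral_indicator_const Metric.isClosed_closedBall.measurableSet _
    _ < ∞ := ENNReal.mul_lt_top (by simp) measure_closedBall_lt_top

/-- A law with infinite, absolutely continuous and symmetric Lévy measure has a density. -/
theorem absolutelyContinuous_of_charFun {P : Measure E} [IsProbabilityMeasure P] {j : E → ℝ≥0∞}
    (hjm : Measurable j) (hj : ∀ y, j (-y) = j y)
    (hfin : ∀ ξ, ∫⁻ y, ENNReal.ofReal (1 - Real.cos (inner ℝ ξ y)) * j y ≠ ∞)
    (hinf : ∫⁻ y, j y = ∞)
    (hP : ∀ ξ, charFun P ξ = ((Real.exp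
      (-(∫⁻ y, ENNReal.ofReal (1 - Real.cos (inner ℝ ξ y)) * j y).toReal) : ℝ) : ℂ)) :
    P ≪ volume := by
  have hfinite : ∀ k, IsFiniteMeasure ((volume : Measure E).withDensity (truncDensity j k)) :=
    fun k => isFiniteMeasure_withDensity (lintegral_truncDensity_lt_top j k).ne
  have hfinite' : ∀ k m, IsFiniteMeasure ((volume : Measure E).withDensity
      (truncDensity j m - truncDensity j k)) := fun k m =>
    isFiniteMeasure_withDensity ((lintegral_mono fun y => tsub_le_self).trans_lt
      (lintegral_truncDensity_lt_top j m)).ne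
  set ν : ℕ → Measure E := fun k => volume.withDensity (truncDensity j k)
  have hcm : ∀ ξ : E, Measurable fun y : E => ENNReal.ofReal (1 - Real.cos (inner ℝ ξ y)) :=
    fun ξ => by fun_prop
  have key : ∀ k (A : Set E), volume A = 0 →
      P A ≤ ENNReal.ofReal (Real.exp (-(ν k).real univ)) := by
    intro k A hA
    refine ENNReal.le_of_forall_pos_le_add fun ε hε _ => ?_
    have hac : ν k ≪ volume := withDensity_absolutelyContinuous _ _
    have : IsFiniteMeasure (compoundPoissonJump (ν k)) :=
      isFiniteMeasure_of_le _ (compoundPoissonJump_le _)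
    obtain ⟨δ, hδ, hδ'⟩ := exists_forall_le_of_absolutelyContinuous
      (compoundPoissonJump_absolutelyContinuous hac) (ε := ε) (by exact_mod_cast hε.ne')
    -- An open neighbourhood replaces the null set, because weak convergence controls the limit law
    -- only on open sets.
    obtain ⟨U, hAU, hU, hUδ⟩ := A.exists_isOpen_lt_of_lt δ (by rw [hA]; exact hδ)
    refine (measure_mono hAU).trans ?_
    -- The factor of `ν k` is kept fixed while the rest of the Lévy measure is filled in. The shift
    -- `m + k` makes the truncated difference a true difference.
    let Q : ℕ → ProbabilityMeasure E := fun m =>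
      ⟨(compoundPoisson (volume.withDensity (truncDensity j (m + k) - truncDensity j k))).conv
        (compoundPoisson (ν k)), inferInstance⟩
    have hQ : Tendsto Q atTop (𝓝 ⟨P, inferInstance⟩) := by
      refine ProbabilityMeasure.tendsto_of_tendsto_charFun fun ξ => ?_
      have hsum : ∀ m, ∫⁻ y, ENNReal.ofReal (1 - Real.cos (inner ℝ ξ y)) * truncDensity j m y ≠ ∞ :=
        fun m => ne_top_of_le_ne_top (hfin ξ) (lintegral_mono fun y => by
          gcongr
          exact (truncDensity_mono j y).ge_of_tendsto (tendsto_truncDensity j y) m)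
      have hval : ∀ m, charFun (Q m : Measure E) ξ = ((Real.exp (-(∫⁻ y, ENNReal.ofReal
          (1 - Real.cos (inner ℝ ξ y)) * truncDensity j (m + k) y).toReal) : ℝ) : ℂ) := by
        intro m
        have hle : ∀ y, truncDensity j k y ≤ truncDensity j (m + k) y :=
          fun y => truncDensity_mono j y (Nat.le_add_left _ _)
        change charFun (Measure.conv _ _) ξ = _
        rw [charFun_conv, charFun_compoundPoisson_withDensity
            ((measurable_truncDensity hjm _).sub (measurable_truncDensity hjm _))
            (fun y => by simp only [Pi.sub_apply, truncDensity_neg hj]),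
          charFun_compoundPoisson_withDensity (measurable_truncDensity hjm _)
            (truncDensity_neg hj k), ← Complex.ofReal_mul, ← Real.exp_add]
        rw [← neg_add, ← ENNReal.toReal_add _ (hsum k), ← lintegral_add_right (g := fun y =>
            ENNReal.ofReal (1 - Real.cos (inner ℝ ξ y)) * truncDensity j k y) _
          ((hcm ξ).mul (measurable_truncDensity hjm _))]
        · congr 5
          ext y
          rw [← mul_add, Pi.sub_apply, tsub_add_cancel_of_le (hle y)]
        · refine ne_top_of_le_ne_top (hsum (m + k)) (lintegral_mono fun y => ?_)
          gcongr
          exact tsub_le_self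
      simp_rw [hval]
      change Tendsto _ _ (𝓝 (charFun P ξ))
      rw [hP]
      refine (Complex.continuous_ofReal.tendsto _).comp
        ((Real.continuous_exp.tendsto _).comp (Tendsto.neg ?_))
      refine (ENNReal.tendsto_toReal (hfin ξ)).comp ?_
      refine (tendsto_add_atTop_iff_nat (f := fun m => ∫⁻ y, ENNReal.ofReal
          (1 - Real.cos (inner ℝ ξ y)) * truncDensity j m y) k).2 ?_
      refine lintegral_tendsto_of_tendsto_of_monotone
        (fun m => ((hcm ξ).mul (measurable_truncDensity hjm _)).aemeasurable)
        (ae_of_all _ fun y a b hab => ?_) (ae_of_all _ fun y => ?_)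
      · exact mul_le_mul_right (truncDensity_mono j y hab) _
      · exact ENNReal.Tendsto.const_mul (tendsto_truncDensity j y) (Or.inr ENNReal.ofReal_ne_top)
    refine (ProbabilityMeasure.le_liminf_measure_open_of_tendsto hQ hU).trans ?_
    refine liminf_le_of_frequently_le' (Frequently.of_forall fun m => ?_)
    refine conv_apply_le_of_forall_le (fun B hB hBδ => ?_) hU.measurableSet hUδ
    exact (compoundPoisson_apply_le _ hB).trans (by gcongr; exact hδ' B hBδ)
  have hmass : Tendsto (fun k => (ν k) univ) atTop (𝓝 ∞) := by
    simp_rw [ν, withDensity_apply _ MeasurableSet.univ, Measure.restrict_univ]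
    rw [← hinf]
    exact lintegral_tendsto_of_tendsto_of_monotone
      (fun m => (measurable_truncDensity hjm _).aemeasurable)
      (ae_of_all _ fun y => truncDensity_mono j y) (ae_of_all _ fun y => tendsto_truncDensity j y)
  have hmass' : Tendsto (fun k => (ν k).real univ) atTop atTop := by
    rw [tendsto_atTop]
    intro b
    have := (ENNReal.tendsto_nhds_top_iff_nnreal.1 hmass) b.toNNReal
    filter_upwards [this] with k hk
    refine (Real.le_coe_toNNReal b).trans ?_
    have h2 := ENNReal.toReal_mono (measure_ne_top (ν k) univ) hk.le
    simpa [measureReal_def] using h2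
  have hlim : Tendsto (fun k => ENNReal.ofReal (Real.exp (-(ν k).real univ))) atTop (𝓝 0) := by
    rw [← ENNReal.ofReal_zero]
    exact (ENNReal.continuous_ofReal.tendsto 0).comp
      (Real.tendsto_exp_neg_atTop_nhds_zero.comp hmass')
  intro A hA
  exact le_antisymm (ge_of_tendsto' hlim fun k => key k A hA) (zero_le)

end CompoundPoisson

/-! ### Bounded densities from integrable characteristic functions -/

section BoundedDensity

open scoped FourierTransform SchwartzMap ContDiff Manifold

variable {E : Type*} [NormedAddCommGroup E] [InnerProductSpace ℝ E] [MeasurableSpace E]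
  [BorelSpace E] [FiniteDimensional ℝ E]

/-- Fourier inversion in dual form: write `h` as the transform of `𝓕⁻ h`, move that transform onto
`P`, then move the inverse transform from `h` onto the characteristic function, where it is bounded
by the $L^1$ norm. The frequency $-2\pi\xi$ reconciles the two normalisations. -/
lemma norm_integral_schwartz_le {P : Measure E} [IsProbabilityMeasure P]
    (hint : Integrable fun ξ => charFun P (-(2 * Real.pi) • ξ)) (h : 𝓢(E, ℂ)) :
    ‖∫ x, h x ∂P‖ ≤ (∫ ξ, ‖charFun P (-(2 * Real.pi) • ξ)‖) * ∫ x, ‖h x‖ := by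
  set G : E → ℂ := fun ξ => charFun P (-(2 * Real.pi) • ξ)
  have hG : ∀ x, VectorFourier.fourierIntegral Real.fourierChar P (innerₗ E).flip
      (fun _ => (1 : ℂ)) x = G x := by
    intro x
    simp only [G]
    rw [charFun_eq_fourierIntegral', flip_innerₗ, smul_smul]
    have : -(2 * Real.pi)⁻¹ * -(2 * Real.pi) = 1 := by
      have := Real.pi_pos; field_simp
    rw [this, one_smul]
    rfl
  have h1 : ∫ x, h x ∂P = ∫ ξ, (𝓕⁻ h) ξ * G ξ := by
    have := VectorFourier.integral_fourierIntegral_smul_eq_flip (μ := volume) (ν := P)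
      (L := innerₗ E) Real.continuous_fourierChar continuous_inner
      (𝓕⁻ h).integrable (integrable_const (1 : ℂ))
    simp only [smul_eq_mul, mul_one, hG] at this
    rw [← this]
    refine integral_congr_ae (ae_of_all _ fun x => ?_)
    have h2 : 𝓕 (𝓕⁻ h) = h := FourierTransform.fourier_fourierInv_eq h
    calc h x = (𝓕 (𝓕⁻ h)) x := by rw [h2]
      _ = _ := by rw [SchwartzMap.fourier_coe]; rfl
  -- The inverse transform is the forward transform for the negated pairing, so the same exchange
  -- identity applies.
  have h3 : ∫ ξ, (𝓕⁻ h) ξ * G ξ = ∫ x, h x *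
      VectorFourier.fourierIntegral Real.fourierChar volume (-innerₗ E).flip G x := by
    have := VectorFourier.integral_fourierIntegral_smul_eq_flip (μ := volume) (ν := volume)
      (L := -innerₗ E) Real.continuous_fourierChar (by
        have : Continuous fun p : E × E => -(inner ℝ p.1 p.2) := by fun_prop
        exact this)
      h.integrable hint
    simp only [smul_eq_mul] at this
    rw [← this]
    refine integral_congr_ae (ae_of_all _ fun x => ?_)
    simp only
    congr 1
    rw [SchwartzMap.fourierInv_coe, Real.fourierInv_eq]
    simp [VectorFourier.fourierIntegral]
  rw [h1, h3]
  refine (norm_integral_le_integral_norm _).trans ?_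
  rw [← integral_const_mul]
  refine integral_mono_of_nonneg (ae_of_all _ fun x => norm_nonneg _)
    (h.integrable.norm.const_mul _) (ae_of_all _ fun x => ?_)
  simp only [norm_mul]
  rw [mul_comm]
  gcongr
  exact VectorFourier.norm_fourierIntegral_le_integral_norm _ _ _ _ _

omit [MeasurableSpace E] [BorelSpace E] in
lemma exists_schwartz_between {K U : Set E} (hK : IsCompact K) (hU : IsOpen U) (hKU : K ⊆ U) :
    ∃ h : E → ℝ, (∃ H : 𝓢(E, ℂ), ∀ x, H x = (h x : ℂ)) ∧ (∀ x, 0 ≤ h x) ∧ (∀ x, h x ≤ 1) ∧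
      (∀ x ∈ K, h x = 1) ∧ (∀ x ∉ U, h x = 0) ∧ HasCompactSupport h := by
  obtain ⟨V, hV, hKV, hVU, hVc⟩ := exists_open_between_and_isCompact_closure hK hU hKU
  obtain ⟨f, hf1, hf0, hf⟩ := exists_contMDiffMap_one_nhds_of_subset_interior (n := (⊤ : ℕ∞)) 𝓘(ℝ, E)
    hK.isClosed (t := V) (by rwa [hV.interior_eq])
  have hfs : HasCompactSupport (f : E → ℝ) := by
    refine HasCompactSupport.intro hVc fun x hx => hf0 x fun h => hx (subset_closure h)
  have hsm : ContDiff ℝ ∞ (f : E → ℝ) := f.contMDiff.contDiff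
  have hsm' : ContDiff ℝ ∞ (fun x => (f x : ℂ)) := Complex.ofRealCLM.contDiff.comp hsm
  have hfs' : HasCompactSupport (fun x => (f x : ℂ)) :=
    hfs.comp_left (g := ((↑) : ℝ → ℂ)) Complex.ofReal_zero
  refine ⟨f, ⟨hfs'.toSchwartzMap hsm', fun x => rfl⟩, fun x => (hf x).1, fun x => (hf x).2,
    fun x hx => hf1.self_of_nhdsSet x hx, fun x hx => hf0 x fun h => hx (hVU (subset_closure h)),
    hfs⟩

/-- A law with integrable characteristic function has a bounded density. -/
theorem measure_le_of_integrable_charFun {P : Measure E} [IsProbabilityMeasure P]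
    (hint : Integrable fun ξ => charFun P (-(2 * Real.pi) • ξ)) {M : ℝ}
    (hM : ∫ ξ, ‖charFun P (-(2 * Real.pi) • ξ)‖ ≤ M) : P ≤ ENNReal.ofReal M • volume := by
  have hM0 : 0 ≤ M := (integral_nonneg fun _ => norm_nonneg _).trans hM
  -- Smooth bumps between compact subsets and `U` reduce open sets to the Schwartz estimate; outer
  -- regularity then covers all sets.
  have hopen : ∀ U : Set E, IsOpen U → P U ≤ ENNReal.ofReal M * volume U := by
    intro U hU
    rw [hU.measure_eq_iSup_isCompact]
    refine iSup₂_le fun K hKU => iSup_le fun hK => ?_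
    obtain ⟨h, ⟨H, hH⟩, h0, h1, hhK, hhU, hhc⟩ := exists_schwartz_between hK hU hKU
    have hbd := norm_integral_schwartz_le hint H
    have hHint : Integrable h := by
      have := H.integrable (μ := volume) |>.re
      simpa [hH] using this
    have hnorm : ∀ x, ‖H x‖ = h x := fun x => by
      rw [hH, Complex.norm_real, Real.norm_of_nonneg (h0 x)]
    have hPint : ∫ x, H x ∂P = ((∫ x, h x ∂P : ℝ) : ℂ) := by
      simp_rw [hH]; exact integral_ofReal
    have hcont : Measurable h := by
      have : h = fun x => (H x).re := by ext x; simp [hH]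
      rw [this]
      exact Complex.measurable_re.comp H.continuous.measurable
    rw [hPint, Complex.norm_real, Real.norm_of_nonneg (integral_nonneg h0)] at hbd
    simp_rw [hnorm] at hbd
    have hPi : Integrable h P := Integrable.of_bound (C := 1) hcont.aestronglyMeasurable
      (ae_of_all _ fun x => by rw [Real.norm_of_nonneg (h0 x)]; exact h1 x)
    calc P K = ∫⁻ x, K.indicator 1 x ∂P := (lintegral_indicator_one hK.measurableSet).symm
      _ ≤ ∫⁻ x, ENNReal.ofReal (h x) ∂P := by
          refine lintegral_mono fun x => ?_
          by_cases hx : x ∈ K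
          · simp [hx, hhK x hx]
          · simp [hx]
      _ = ENNReal.ofReal (∫ x, h x ∂P) :=
          (ofReal_integral_eq_lintegral_ofReal hPi (ae_of_all _ h0)).symm
      _ ≤ ENNReal.ofReal (M * ∫ x, h x) := by
          refine ENNReal.ofReal_le_ofReal (hbd.trans ?_)
          exact mul_le_mul_of_nonneg_right hM (integral_nonneg h0)
      _ = ENNReal.ofReal M * ∫⁻ x, ENNReal.ofReal (h x) := by
          rw [ENNReal.ofReal_mul hM0,
            ofReal_integral_eq_lintegral_ofReal hHint (ae_of_all _ h0)]
      _ ≤ ENNReal.ofReal M * ∫⁻ x, U.indicator 1 x := by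
          gcongr with x
          by_cases hx : x ∈ U
          · simpa [hx] using h1 x
          · simp [hx, hhU x hx]
      _ = ENNReal.ofReal M * volume U := by rw [lintegral_indicator_one hU.measurableSet]
  refine Measure.le_iff.2 fun A _ => ?_
  have : (ENNReal.ofReal M • (volume : Measure E)).OuterRegular :=
    Measure.OuterRegular.smul _ ENNReal.ofReal_ne_top
  refine le_of_forall_gt_imp_ge_of_dense fun r hr => ?_
  obtain ⟨U, hAU, hU, hUr⟩ := A.exists_isOpen_lt_of_lt r hr
  exact (measure_mono hAU).trans ((hopen U hU).trans hUr.le)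

end BoundedDensity

/-! ### Elementary properties of Bernstein functions -/

section Bernstein

lemma one_sub_exp_neg_le {x t : ℝ} (ht : 0 ≤ t) :
    1 - Real.exp (-(x * t)) ≤ max 1 x * min 1 t := by
  have h1 : 1 - Real.exp (-(x * t)) ≤ 1 := by linarith [Real.exp_pos (-(x * t))]
  have h2 : 1 - Real.exp (-(x * t)) ≤ x * t := by linarith [Real.add_one_le_exp (-(x * t))]
  rcases le_total 1 t with h | h
  · rw [min_eq_left h, mul_one]; exact h1.trans (le_max_left _ _)
  · rw [min_eq_right h]; exact h2.trans (by gcongr; exact le_max_right _ _)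

lemma one_sub_exp_neg_nonneg {x t : ℝ} (hx : 0 ≤ x) (ht : 0 ≤ t) :
    0 ≤ 1 - Real.exp (-(x * t)) := by
  have : Real.exp (-(x * t)) ≤ 1 := Real.exp_le_one_iff.2 (by nlinarith [mul_nonneg hx ht])
  linarith

namespace HasBernsteinRepr

variable {f : ℝ → ℝ} {a b : ℝ} {ρ : Measure ℝ}

lemma ae_pos (h : HasBernsteinRepr f a b ρ) : ∀ᵐ t ∂ρ, 0 < t := by
  rw [ae_iff]
  convert h.support using 2
  ext t; simp

lemma integrable (h : HasBernsteinRepr f a b ρ) {x : ℝ} (hx : 0 ≤ x) :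
    Integrable (fun t => 1 - Real.exp (-(x * t))) ρ := by
  have hmin : Integrable (fun t : ℝ => min 1 t) ρ := by
    refine (lintegral_ofReal_ne_top_iff_integrable (by fun_prop) ?_).1 h.lintegral_lt_top.ne
    filter_upwards [h.ae_pos] with t ht
    exact le_min zero_le_one ht.le
  refine (hmin.const_mul (max 1 x)).mono' (by fun_prop) ?_
  filter_upwards [h.ae_pos] with t ht
  rw [Real.norm_of_nonneg (one_sub_exp_neg_nonneg hx ht.le)]
  exact one_sub_exp_neg_le ht.le

lemma nonneg (h : HasBernsteinRepr f a b ρ) {x : ℝ} (hx : 0 ≤ x) : 0 ≤ f x := by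
  rw [h.eq_integral x hx]
  have h1 := h.a_nonneg
  have h2 := mul_nonneg h.b_nonneg hx
  have h3 : 0 ≤ ∫ t, (1 - Real.exp (-(x * t))) ∂ρ := by
    refine integral_nonneg_of_ae ?_
    filter_upwards [h.ae_pos] with t ht
    exact one_sub_exp_neg_nonneg hx ht.le
  linarith

lemma monotoneOn (h : HasBernsteinRepr f a b ρ) : MonotoneOn f (Ici 0) := by
  intro x hx y hy hxy
  rw [h.eq_integral x hx, h.eq_integral y hy]
  have h2 := mul_le_mul_of_nonneg_left hxy h.b_nonneg
  have h3 : ∫ t, (1 - Real.exp (-(x * t))) ∂ρ ≤ ∫ t, (1 - Real.exp (-(y * t))) ∂ρ := by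
    refine integral_mono_ae (h.integrable hx) (h.integrable hy) ?_
    filter_upwards [h.ae_pos] with t ht
    have := mul_le_mul_of_nonneg_right hxy ht.le
    simp only [sub_le_sub_iff_left, Real.exp_le_exp]
    linarith
  linarith

lemma ofReal_eq (h : HasBernsteinRepr f a b ρ) {x : ℝ} (hx : 0 ≤ x) :
    ENNReal.ofReal (f x) = ENNReal.ofReal (a + b * x) +
      ∫⁻ t, ENNReal.ofReal (1 - Real.exp (-(x * t))) ∂ρ := by
  have hpos : 0 ≤ᵐ[ρ] fun t => 1 - Real.exp (-(x * t)) := by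
    filter_upwards [h.ae_pos] with t ht
    exact one_sub_exp_neg_nonneg hx ht.le
  rw [h.eq_integral x hx, ENNReal.ofReal_add
    (add_nonneg h.a_nonneg (mul_nonneg h.b_nonneg hx)) (integral_nonneg_of_ae hpos),
    ofReal_integral_eq_lintegral_ofReal (h.integrable hx) hpos]

end HasBernsteinRepr

end Bernstein

/-! ### The jump density -/

section JumpDensity

variable {n : ℕ} {g : ℝ → ℝ}

/-- The values of `g` on the negative axis are arbitrary, so `g` itself need not be measurable;
cutting at `0` gives a function monotone on all of $\mathbb R$. -/
lemma measurable_comp_max_zero (hg : MonotoneOn g (Ici 0)) : Measurable fun x => g (max 0 x) := by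
  refine Monotone.measurable fun x y hxy => ?_
  exact hg (mem_Ici.2 (le_max_left _ _)) (mem_Ici.2 (le_max_left _ _)) (max_le_max le_rfl hxy)

lemma measurable_jumpDensity (hg : MonotoneOn g (Ici 0)) :
    Measurable (jumpDensity g : EuclideanSpace ℝ (Fin n) → ℝ) := by
  have : (jumpDensity g : EuclideanSpace ℝ (Fin n) → ℝ) =
      fun y => g (max 0 (1 / ‖y‖ ^ 2)) / ‖y‖ ^ n := by
    ext y; rw [jumpDensity, max_eq_right (by positivity)]
  rw [this]
  exact ((measurable_comp_max_zero hg).comp (by fun_prop)).div (by fun_prop)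

lemma jumpDensity_nonneg (hg : ∀ x, 0 ≤ x → 0 ≤ g x) (y : EuclideanSpace ℝ (Fin n)) :
    0 ≤ jumpDensity g y :=
  div_nonneg (hg _ (by positivity)) (by positivity)

lemma jumpDensity_neg (y : EuclideanSpace ℝ (Fin n)) : jumpDensity g (-y) = jumpDensity g y := by
  simp [jumpDensity]

end JumpDensity

/-! ### A uniform lower bound for the cosine integral over an annulus -/

section Annulus

open scoped FourierTransform

variable {E : Type*} [NormedAddCommGroup E] [InnerProductSpace ℝ E] [MeasurableSpace E]
  [BorelSpace E] [FiniteDimensional ℝ E]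

/-- The open annulus `{a / 2 < ‖w‖ < a}`. -/
def annulus (E : Type*) [Norm E] (a : ℝ) : Set E := {w | a / 2 < ‖w‖ ∧ ‖w‖ < a}

omit [InnerProductSpace ℝ E] [MeasurableSpace E] [BorelSpace E] [FiniteDimensional ℝ E] in
lemma isOpen_annulus (a : ℝ) : IsOpen (annulus E a) :=
  (isOpen_lt continuous_const continuous_norm).inter (isOpen_lt continuous_norm continuous_const)

omit [InnerProductSpace ℝ E] [FiniteDimensional ℝ E] in
lemma measurableSet_annulus (a : ℝ) : MeasurableSet (annulus E a) :=
  (isOpen_annulus a).measurableSet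

lemma volume_annulus_lt_top (a : ℝ) : volume (annulus E a) < ∞ :=
  (measure_mono fun w hw => by simpa using hw.2).trans_lt
    (measure_ball_lt_top (x := (0 : E)) (r := a))

lemma integrableOn_annulus_one_sub_cos (η : E) (a : ℝ) :
    IntegrableOn (fun w => 1 - Real.cos (inner ℝ η w)) (annulus E a) := by
  have : IsFiniteMeasure ((volume : Measure E).restrict (annulus E a)) :=
    ⟨by simpa using volume_annulus_lt_top a⟩
  refine Integrable.of_bound (C := 2) (by fun_prop) (ae_of_all _ fun w => ?_)
  rw [Real.norm_eq_abs, abs_le]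
  constructor <;> linarith [Real.neg_one_le_cos (inner ℝ η w), Real.cos_le_one (inner ℝ η w)]

omit [MeasurableSpace E] [BorelSpace E] [FiniteDimensional ℝ E] in
-- On the ray through `η`, the radii $0.6$ and $0.6\sqrt2$ both lie in $(1/2,1)$. If both cosines
-- were $1$, the ratio $\sqrt2$ of the phases would be rational.
lemma exists_mem_annulus_cos_ne_one {η : E} (hη : η ≠ 0) :
    ∃ w ∈ annulus E 1, Real.cos (inner ℝ η w) ≠ 1 := by
  have hη' : 0 < ‖η‖ := norm_pos_iff.2 hη
  have hsq : Real.sqrt 2 < 1.6 := by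
    rw [Real.sqrt_lt' (by norm_num)]; norm_num
  have hsq1 : 1 < Real.sqrt 2 := by
    rw [Real.lt_sqrt (by norm_num)]; norm_num
  have hmem : ∀ r : ℝ, 1 / 2 < r → r < 1 → (r / ‖η‖) • η ∈ annulus E 1 := by
    intro r hr hr1
    have : ‖(r / ‖η‖) • η‖ = r := by
      rw [norm_smul, Real.norm_of_nonneg (by positivity)]; field_simp
    simp only [annulus, mem_ofPred_eq, this]
    exact ⟨hr, hr1⟩
  have hin : ∀ r : ℝ, inner ℝ η ((r / ‖η‖) • η) = r * ‖η‖ := by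
    intro r
    rw [real_inner_smul_right, real_inner_self_eq_norm_sq]; field_simp
  by_contra! H
  have h1 := H _ (hmem 0.6 (by norm_num) (by norm_num))
  have h2 := H _ (hmem (0.6 * Real.sqrt 2) (by linarith) (by linarith))
  rw [hin, Real.cos_eq_one_iff] at h1 h2
  obtain ⟨k, hk⟩ := h1
  obtain ⟨l, hl⟩ := h2
  have hk0 : (k : ℝ) ≠ 0 := by
    intro h
    rw [h, zero_mul] at hk
    have : 0 < 0.6 * ‖η‖ := by positivity
    linarith
  refine (irrational_iff_ne_rational _).1 irrational_sqrt_two l k (by exact_mod_cast hk0) ?_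
  rw [eq_div_iff hk0]
  have hpi : (2 * Real.pi) ≠ 0 := by positivity
  apply mul_right_cancel₀ hpi
  rw [hl, mul_assoc, hk]; ring

lemma integral_annulus_one_sub_cos_pos {η : E} (hη : η ≠ 0) :
    0 < ∫ w in annulus E 1, (1 - Real.cos (inner ℝ η w)) := by
  rw [setIntegral_pos_iff_support_of_nonneg_ae
    (ae_of_all _ fun w => sub_nonneg.2 (Real.cos_le_one _)) (integrableOn_annulus_one_sub_cos η 1)]
  obtain ⟨w, hw, hc⟩ := exists_mem_annulus_cos_ne_one hη
  have hcont : Continuous fun w : E => 1 - Real.cos (inner ℝ η w) := by fun_prop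
  refine (hcont.isOpen_support.inter (isOpen_annulus 1)).measure_pos _ ⟨w, ?_, hw⟩
  exact sub_ne_zero.2 hc.symm

/-- Riemann–Lebesgue for the indicator of the annulus; the factor $(2\pi)^{-1}$ converts between the
conventions for the frequency. -/
lemma tendsto_integral_annulus_one_sub_cos :
    Tendsto (fun η : E => ∫ w in annulus E 1, (1 - Real.cos (inner ℝ η w))) (cocompact E)
      (𝓝 (volume.real (annulus E 1))) := by
  have : IsFiniteMeasure ((volume : Measure E).restrict (annulus E 1)) :=
    ⟨by simpa using volume_annulus_lt_top 1⟩
  have h := tendsto_integral_exp_inner_smul_cocompact (V := E)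
    ((annulus E 1).indicator fun _ => (1 : ℂ))
  have hpi : (2 * Real.pi)⁻¹ ≠ 0 := by positivity
  have h2 : Tendsto (fun η : E => (2 * Real.pi)⁻¹ • η) (cocompact E) (cocompact E) :=
    (Homeomorph.smulOfNeZero _ hpi).isClosedEmbedding.tendsto_cocompact
  have h3 := (Complex.continuous_re.tendsto _).comp (h.comp h2)
  have h4 : ∀ η : E, ∫ w in annulus E 1, (1 - Real.cos (inner ℝ η w)) =
      volume.real (annulus E 1) - (∫ v : E, Real.fourierChar (-inner ℝ v ((2 * Real.pi)⁻¹ • η)) •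
        (annulus E 1).indicator (fun _ => (1 : ℂ)) v).re := by
    intro η
    have hi : Integrable (fun w => Real.cos (inner ℝ η w)) (volume.restrict (annulus E 1)) :=
      Integrable.of_bound (C := 1) (by fun_prop) (ae_of_all _ fun x => Real.abs_cos_le_one _)
    rw [integral_sub (integrable_const _) hi]
    congr 1
    · simp
    · have h5 : ∀ v : E, Real.fourierChar (-inner ℝ v ((2 * Real.pi)⁻¹ • η)) •
        (annulus E 1).indicator (fun _ => (1 : ℂ)) v = (annulus E 1).indicator
          (fun v => Complex.exp ((-inner ℝ η v : ℝ) * Complex.I)) v := by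
        intro v
        by_cases hv : v ∈ annulus E 1
        · rw [indicator_of_mem hv, indicator_of_mem hv, Circle.smul_def, Real.fourierChar_apply,
            smul_eq_mul, mul_one, real_inner_smul_right, real_inner_comm]
          congr 3
          field_simp
        · simp [hv]
      simp_rw [h5]
      rw [integral_indicator (measurableSet_annulus 1)]
      have hint : Integrable (fun v : E => Complex.exp ((-inner ℝ η v : ℝ) * Complex.I))
          (volume.restrict (annulus E 1)) := by
        refine Integrable.of_bound (C := 1) (by fun_prop) (ae_of_all _ fun x => ?_)
        rw [Complex.norm_exp_ofReal_mul_I]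
      have := integral_re hint
      simp only [RCLike.re_to_complex] at this
      rw [← this]
      congr 1; ext v
      rw [Complex.exp_ofReal_mul_I_re, Real.cos_neg]
  simp_rw [h4]
  simpa using h3.const_sub (volume.real (annulus E 1))

lemma continuous_integral_annulus_one_sub_cos :
    Continuous fun η : E => ∫ w in annulus E 1, (1 - Real.cos (inner ℝ η w)) := by
  have : IsFiniteMeasure ((volume : Measure E).restrict (annulus E 1)) :=
    ⟨by simpa using volume_annulus_lt_top 1⟩
  refine continuous_of_dominated (bound := fun _ => 2) (fun η => by fun_prop)
    (fun η => ae_of_all _ fun w => ?_) (integrable_const _) (ae_of_all _ fun w => by fun_prop)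
  rw [Real.norm_eq_abs, abs_le]
  constructor <;> linarith [Real.neg_one_le_cos (inner ℝ η w), Real.cos_le_one (inner ℝ η w)]

/-- For large `η` the integral exceeds half the volume; the remaining `η` with $|\eta|\ge1$ form a
compact set, on which the continuous positive integral has a positive minimum. -/
lemma exists_le_integral_annulus_one_sub_cos [Nontrivial E] :
    ∃ c > 0, ∀ η : E, 1 ≤ ‖η‖ → c ≤ ∫ w in annulus E 1, (1 - Real.cos (inner ℝ η w)) := by
  have hvol : 0 < volume.real (annulus E 1) := by
    obtain ⟨η, hη⟩ := exists_ne (0 : E)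
    obtain ⟨w, hw, -⟩ := exists_mem_annulus_cos_ne_one hη
    exact ENNReal.toReal_pos ((isOpen_annulus 1).measure_pos _ ⟨w, hw⟩).ne'
      (volume_annulus_lt_top 1).ne
  have hev := (tendsto_integral_annulus_one_sub_cos (E := E)).eventually
    (lt_mem_nhds (half_lt_self hvol))
  obtain ⟨K, hK, hKs⟩ := mem_cocompact.1 hev
  have hK' : IsCompact (K ∩ {η | 1 ≤ ‖η‖}) :=
    hK.inter_right (isClosed_le continuous_const continuous_norm)
  rcases (K ∩ {η | 1 ≤ ‖η‖}).eq_empty_or_nonempty with he | hne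
  · refine ⟨_, half_pos hvol, fun η hη => ?_⟩
    have : η ∈ Kᶜ := fun h => by
      have : η ∈ K ∩ {η | 1 ≤ ‖η‖} := ⟨h, hη⟩
      simp [he] at this
    exact (show _ < _ from hKs this).le
  · obtain ⟨η₀, hη₀, hmin⟩ := hK'.exists_isMinOn hne
      continuous_integral_annulus_one_sub_cos.continuousOn
    have h0 : η₀ ≠ 0 := by
      rintro rfl
      have := hη₀.2
      simp at this
      linarith
    refine ⟨_, lt_min (half_pos hvol) (integral_annulus_one_sub_cos_pos h0), fun η hη => ?_⟩
    by_cases h : η ∈ K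
    · exact (min_le_right _ _).trans (hmin ⟨h, hη⟩)
    · exact (min_le_left _ _).trans (show _ < _ from hKs h).le

end Annulus

/-! ### Lower bound and finiteness for the symbol $\psi_\infty$ -/

section PsiInfty

open scoped Pointwise

variable {n : ℕ} {g : ℝ → ℝ}

lemma smul_annulus_one {a : ℝ} (ha : 0 < a) :
    a • annulus (EuclideanSpace ℝ (Fin n)) 1 = annulus (EuclideanSpace ℝ (Fin n)) a := by
  ext y
  rw [mem_smul_set_iff_inv_smul_mem₀ ha.ne']
  simp only [annulus, mem_ofPred_eq, norm_smul, norm_inv, Real.norm_of_nonneg ha.le]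
  rw [inv_mul_eq_div, div_lt_div_iff₀ (by norm_num) ha, div_lt_one ha, div_lt_iff₀ (by norm_num)]
  simp only [one_mul]

/-- Rescaling by `a` produces the Jacobian $a^{-n}$, which is at most $|y|^{-n}$ on the annulus. -/
lemma le_lintegral_annulus {c : ℝ} (hc : ∀ η : EuclideanSpace ℝ (Fin n), 1 ≤ ‖η‖ →
      c ≤ ∫ w in annulus (EuclideanSpace ℝ (Fin n)) 1, (1 - Real.cos (inner ℝ η w)))
    {a : ℝ} (ha : 0 < a) {ξ : EuclideanSpace ℝ (Fin n)} (h : 1 ≤ a * ‖ξ‖) :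
    ENNReal.ofReal c ≤ ∫⁻ y in annulus (EuclideanSpace ℝ (Fin n)) a,
      ENNReal.ofReal ((1 - Real.cos (inner ℝ ξ y)) / ‖y‖ ^ n) := by
  have h1 := hc (a • ξ) (by rwa [norm_smul, Real.norm_of_nonneg ha.le])
  have h2 := Measure.setIntegral_comp_smul_of_pos (volume : Measure (EuclideanSpace ℝ (Fin n)))
    (fun y => 1 - Real.cos (inner ℝ ξ y)) (annulus _ 1) ha
  rw [smul_annulus_one ha, finrank_euclideanSpace_fin, smul_eq_mul] at h2
  have h3 : ∀ w : EuclideanSpace ℝ (Fin n), inner ℝ (a • ξ) w = inner ℝ ξ (a • w) := by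
    intro w; rw [real_inner_smul_left, real_inner_smul_right]
  simp_rw [h3, h2] at h1
  rw [← integral_const_mul] at h1
  calc ENNReal.ofReal c ≤ ENNReal.ofReal (∫ y in annulus (EuclideanSpace ℝ (Fin n)) a,
        (a ^ n)⁻¹ * (1 - Real.cos (inner ℝ ξ y))) := ENNReal.ofReal_le_ofReal h1
    _ = ∫⁻ y in annulus (EuclideanSpace ℝ (Fin n)) a,
        ENNReal.ofReal ((a ^ n)⁻¹ * (1 - Real.cos (inner ℝ ξ y))) :=
        ofReal_integral_eq_lintegral_ofReal
          ((integrableOn_annulus_one_sub_cos ξ a).const_mul _) (ae_of_all _ fun y =>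
            mul_nonneg (by positivity) (sub_nonneg.2 (Real.cos_le_one _)))
    _ ≤ _ := by
        refine setLIntegral_mono' (measurableSet_annulus a) fun y hy => ENNReal.ofReal_le_ofReal ?_
        have hy0 : 0 < ‖y‖ := lt_trans (by positivity) hy.1
        rw [mul_comm, div_eq_mul_inv]
        have := sub_nonneg.2 (Real.cos_le_one (inner ℝ ξ y))
        gcongr
        exact hy.2.le

/-- The disjoint annuli of outer radii $a, a/2,\dots,a/2^N$ all satisfy the previous estimate, which
gives `N + 1` contributions. -/
lemma le_lintegral_ball {c : ℝ} (hc : ∀ η : EuclideanSpace ℝ (Fin n), 1 ≤ ‖η‖ →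
      c ≤ ∫ w in annulus (EuclideanSpace ℝ (Fin n)) 1, (1 - Real.cos (inner ℝ η w)))
    (ξ : EuclideanSpace ℝ (Fin n)) (N : ℕ) {a : ℝ} (ha : 0 < a) (h : 2 ^ N ≤ a * ‖ξ‖) :
    (N + 1 : ℕ) * ENNReal.ofReal c ≤
      ∫⁻ y in {y : EuclideanSpace ℝ (Fin n) | 0 < ‖y‖ ∧ ‖y‖ < a},
        ENNReal.ofReal ((1 - Real.cos (inner ℝ ξ y)) / ‖y‖ ^ n) := by
  induction N generalizing a with
  | zero =>
    simp only [zero_add, Nat.cast_one, one_mul]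
    refine (le_lintegral_annulus hc ha (by simpa using h)).trans (lintegral_mono_set fun y hy => ?_)
    exact ⟨lt_trans (by positivity) hy.1, hy.2⟩
  | succ N ih =>
    have h1 := le_lintegral_annulus hc ha (le_trans (one_le_pow₀ (by norm_num)) h)
    have h2 := ih (half_pos ha) (by rw [pow_succ] at h; linarith)
    have hd : Disjoint {y : EuclideanSpace ℝ (Fin n) | 0 < ‖y‖ ∧ ‖y‖ < a / 2} (annulus _ a) := by
      rw [Set.disjoint_left]
      intro y hy hy'
      exact lt_asymm hy.2 hy'.1
    calc ((N + 1 + 1 : ℕ) : ℝ≥0∞) * ENNReal.ofReal c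
        = (N + 1 : ℕ) * ENNReal.ofReal c + ENNReal.ofReal c := by push_cast; ring
      _ ≤ _ := add_le_add h2 h1
      _ = _ := (lintegral_union (measurableSet_annulus a) hd).symm
      _ ≤ _ := by
        refine lintegral_mono_set fun y hy => ?_
        rcases hy with hy | hy
        · exact ⟨hy.1, hy.2.trans (half_lt_self ha)⟩
        · exact ⟨lt_trans (by positivity) hy.1, hy.2⟩

lemma exists_psiInfty_lower_bound (hn : 1 ≤ n) : ∃ κ : ℝ, 0 < κ ∧ ∀ g : ℝ → ℝ,
    (∀ x, 0 ≤ x → 0 ≤ g x) → MonotoneOn g (Ici 0) →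
    ∀ (s : ℝ) (ξ : EuclideanSpace ℝ (Fin n)), 0 < s → s ≤ ‖ξ‖ ^ 2 →
      ENNReal.ofReal (κ * g s * Real.log (‖ξ‖ ^ 2 / s)) ≤
        ∫⁻ y, ENNReal.ofReal (1 - Real.cos (inner ℝ ξ y)) * ENNReal.ofReal (jumpDensity g y) := by
  have : Nonempty (Fin n) := ⟨⟨0, hn⟩⟩
  obtain ⟨c, hc0, hc⟩ := exists_le_integral_annulus_one_sub_cos (E := EuclideanSpace ℝ (Fin n))
  have hlog2 : 0 < Real.log 2 := Real.log_pos (by norm_num)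
  -- With $a=s^{-1/2}$ and $2^N\le a|\xi|<2^{N+1}$, one has $\log(|\xi|^2/s)=2\log(a|\xi|)\le
  -- 2(N+1)\log2$; hence the divisor.
  refine ⟨c / (2 * Real.log 2), by positivity, fun g hg0 hg s ξ hs hsξ => ?_⟩
  have hr : 0 < Real.sqrt s := Real.sqrt_pos.2 hs
  set a := (Real.sqrt s)⁻¹ with ha_def
  have ha : 0 < a := inv_pos.2 hr
  have hsq : (a * ‖ξ‖) ^ 2 = ‖ξ‖ ^ 2 / s := by
    rw [mul_pow, ha_def, inv_pow, Real.sq_sqrt hs.le]; field_simp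
  have h1 : 1 ≤ a * ‖ξ‖ := by
    rw [← one_le_sq_iff₀ (by positivity), hsq, one_le_div hs]; exact hsξ
  obtain ⟨N, hN, hN'⟩ := exists_nat_pow_near h1 (by norm_num : (1 : ℝ) < 2)
  have hlog : Real.log (‖ξ‖ ^ 2 / s) ≤ 2 * ((N + 1 : ℕ) * Real.log 2) := by
    have h2 := Real.log_le_log (by positivity) hN'.le
    rw [Real.log_pow] at h2
    rw [← hsq, Real.log_pow, Nat.cast_ofNat]
    linarith
  have hgs := hg0 s hs.le
  calc ENNReal.ofReal (c / (2 * Real.log 2) * g s * Real.log (‖ξ‖ ^ 2 / s))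
      ≤ ENNReal.ofReal (c / (2 * Real.log 2) * g s * (2 * ((N + 1 : ℕ) * Real.log 2))) := by
        gcongr
    _ = ENNReal.ofReal (g s) * ((N + 1 : ℕ) * ENNReal.ofReal c) := by
        rw [← ENNReal.ofReal_natCast (N + 1), ← ENNReal.ofReal_mul (by positivity),
          ← ENNReal.ofReal_mul hgs]
        congr 1; field_simp
    _ ≤ ENNReal.ofReal (g s) * ∫⁻ y in {y : EuclideanSpace ℝ (Fin n) | 0 < ‖y‖ ∧ ‖y‖ < a},
        ENNReal.ofReal ((1 - Real.cos (inner ℝ ξ y)) / ‖y‖ ^ n) := by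
        gcongr
        exact le_lintegral_ball hc ξ N ha hN
    _ = ∫⁻ y in {y : EuclideanSpace ℝ (Fin n) | 0 < ‖y‖ ∧ ‖y‖ < a}, ENNReal.ofReal (g s) *
        ENNReal.ofReal ((1 - Real.cos (inner ℝ ξ y)) / ‖y‖ ^ n) := by
        rw [lintegral_const_mul _ (by fun_prop)]
    _ ≤ ∫⁻ y in {y : EuclideanSpace ℝ (Fin n) | 0 < ‖y‖ ∧ ‖y‖ < a},
        ENNReal.ofReal (1 - Real.cos (inner ℝ ξ y)) * ENNReal.ofReal (jumpDensity g y) := by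
        refine setLIntegral_mono' ?_ fun y hy => ?_
        · exact (measurableSet_lt measurable_const measurable_norm).inter
            (measurableSet_lt measurable_norm measurable_const)
        · obtain ⟨hy0, hya⟩ := hy
          have hcos := sub_nonneg.2 (Real.cos_le_one (inner ℝ ξ y))
          rw [← ENNReal.ofReal_mul hgs, ← ENNReal.ofReal_mul hcos, jumpDensity]
          refine ENNReal.ofReal_le_ofReal ?_
          have hsy : s ≤ 1 / ‖y‖ ^ 2 := by
            rw [le_div_iff₀ (by positivity), ← le_div_iff₀' hs]
            calc ‖y‖ ^ 2 ≤ a ^ 2 := by gcongr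
              _ = 1 / s := by rw [ha_def, inv_pow, Real.sq_sqrt hs.le, one_div]
          have := hg (mem_Ici.2 hs.le) (mem_Ici.2 (by positivity)) hsy
          calc g s * ((1 - Real.cos (inner ℝ ξ y)) / ‖y‖ ^ n)
              ≤ g (1 / ‖y‖ ^ 2) * ((1 - Real.cos (inner ℝ ξ y)) / ‖y‖ ^ n) := by gcongr
            _ = _ := by ring
    _ ≤ _ := setLIntegral_le_lintegral _ _

/-- The Lévy condition suffices, since $1-\cos(\xi\cdot y)\le\max(2,|\xi|^2)\min(1,|y|^2)$. -/
lemma lintegral_cos_mul_jumpDensity_ne_top (hg0 : ∀ x, 0 ≤ x → 0 ≤ g x)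
    (hν : ∫⁻ y : EuclideanSpace ℝ (Fin n),
      ENNReal.ofReal (min 1 (‖y‖ ^ 2) * jumpDensity g y) < ∞) (ξ : EuclideanSpace ℝ (Fin n)) :
    ∫⁻ y, ENNReal.ofReal (1 - Real.cos (inner ℝ ξ y)) * ENNReal.ofReal (jumpDensity g y) ≠ ∞ := by
  have hbd : ∀ y : EuclideanSpace ℝ (Fin n),
      ENNReal.ofReal (1 - Real.cos (inner ℝ ξ y)) * ENNReal.ofReal (jumpDensity g y) ≤
      ENNReal.ofReal (max 2 (‖ξ‖ ^ 2)) * ENNReal.ofReal (min 1 (‖y‖ ^ 2) * jumpDensity g y) := by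
    intro y
    have hj := jumpDensity_nonneg hg0 y
    rw [← ENNReal.ofReal_mul (sub_nonneg.2 (Real.cos_le_one _)),
      ← ENNReal.ofReal_mul (by positivity), ← mul_assoc]
    refine ENNReal.ofReal_le_ofReal (mul_le_mul_of_nonneg_right ?_ hj)
    rcases le_total 1 (‖y‖ ^ 2) with h | h
    · rw [min_eq_left h, mul_one]
      exact le_trans (by linarith [Real.neg_one_le_cos (inner ℝ ξ y)]) (le_max_left _ _)
    · rw [min_eq_right h]
      have h1 := Real.one_sub_sq_div_two_le_cos (x := inner ℝ ξ y)
      have h2 : (inner ℝ ξ y) ^ 2 ≤ ‖ξ‖ ^ 2 * ‖y‖ ^ 2 := by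
        rw [← mul_pow, ← sq_abs]
        gcongr
        exact abs_real_inner_le_norm ξ y
      calc 1 - Real.cos (inner ℝ ξ y) ≤ ‖ξ‖ ^ 2 * ‖y‖ ^ 2 := by
            nlinarith [sq_nonneg (inner ℝ ξ y)]
        _ ≤ _ := by gcongr; exact le_max_right _ _
  refine ((lintegral_mono hbd).trans_lt ?_).ne
  rw [lintegral_const_mul' _ _ ENNReal.ofReal_ne_top]
  exact ENNReal.mul_lt_top ENNReal.ofReal_lt_top hν

lemma psiInfty_eq_toReal (hg0 : ∀ x, 0 ≤ x → 0 ≤ g x) (hg : MonotoneOn g (Ici 0))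
    (ξ : EuclideanSpace ℝ (Fin n)) : psiInfty g ξ = (∫⁻ y, ENNReal.ofReal
      (1 - Real.cos (inner ℝ ξ y)) * ENNReal.ofReal (jumpDensity g y)).toReal := by
  have hm := measurable_jumpDensity (n := n) hg
  rw [psiInfty, integral_eq_lintegral_of_nonneg_ae]
  · congr 2
    ext y
    rw [ENNReal.ofReal_mul (sub_nonneg.2 (Real.cos_le_one _))]
  · exact ae_of_all _ fun y =>
      mul_nonneg (sub_nonneg.2 (Real.cos_le_one _)) (jumpDensity_nonneg hg0 y)
  · exact (Measurable.mul (by fun_prop) hm).aestronglyMeasurable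

end PsiInfty

/-! ### The function $\mu$ and its representation by Laplace transforms -/

section Mu

/-- Tonelli on $\{r<x\}$. Different choices of `T` and `F` give the Laplace transforms of $x$ and
$\min(x,t)$, and also the single-integral form of $\mu$. -/
lemma lintegral_mul_volume_inter_Iio {F : ℝ → ℝ≥0∞} (hF : Measurable F) {T : Set ℝ}
    (hT : MeasurableSet T) (hT0 : T ⊆ Ioi 0) :
    ∫⁻ x in Ioi 0, F x * volume (T ∩ Iio x) = ∫⁻ r in T, ∫⁻ x in Ioi r, F x := by
  have hset : MeasurableSet {p : ℝ × ℝ | p.1 < p.2} := measurableSet_lt measurable_fst measurable_snd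
  calc ∫⁻ x in Ioi 0, F x * volume (T ∩ Iio x)
      = ∫⁻ x in Ioi 0, ∫⁻ r in T, {p : ℝ × ℝ | p.1 < p.2}.indicator (fun p => F p.2) (r, x) := by
        refine lintegral_congr fun x => ?_
        have : ∀ r, {p : ℝ × ℝ | p.1 < p.2}.indicator (fun p => F p.2) (r, x) =
            (Iio x).indicator (fun _ => F x) r := fun r => rfl
        simp_rw [this]
        rw [lintegral_indicator_const measurableSet_Iio, Measure.restrict_apply measurableSet_Iio,
          inter_comm]
    _ = ∫⁻ r in T, ∫⁻ x in Ioi 0, {p : ℝ × ℝ | p.1 < p.2}.indicator (fun p => F p.2) (r, x) := by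
        refine lintegral_lintegral_swap (Measurable.aemeasurable ?_)
        exact ((hF.comp measurable_snd).indicator hset).comp measurable_swap
    _ = _ := by
        refine setLIntegral_congr_fun hT fun r hr => ?_
        have : ∀ x, {p : ℝ × ℝ | p.1 < p.2}.indicator (fun p => F p.2) (r, x) =
            (Ioi r).indicator F x := fun x => rfl
        simp_rw [this]
        rw [lintegral_indicator measurableSet_Ioi, Measure.restrict_restrict measurableSet_Ioi,
          inter_eq_left.2 (Ioi_subset_Ioi (hT0 hr).le)]

lemma volume_Ioc_inter_Iio (x t : ℝ) :
    volume (Ioc 0 t ∩ Iio x) = ENNReal.ofReal (min x t) := by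
  rcases le_or_gt x t with h | h
  · have : Ioc 0 t ∩ Iio x = Ioo 0 x := by
      ext r; simp only [mem_inter_iff, mem_Ioc, mem_Iio, mem_Ioo]
      exact ⟨fun hr => ⟨hr.1.1, hr.2⟩, fun hr => ⟨⟨hr.1, (hr.2.trans_le h).le⟩, hr.2⟩⟩
    rw [this, Real.volume_Ioo, min_eq_left h, sub_zero]
  · have : Ioc 0 t ∩ Iio x = Ioc 0 t := inter_eq_left.2 fun r hr => hr.2.trans_lt h
    rw [this, Real.volume_Ioc, min_eq_right h.le, sub_zero]

lemma lintegral_Ioi_exp_neg {s : ℝ} (hs : 0 < s) (c : ℝ) :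
    ∫⁻ x in Ioi c, ENNReal.ofReal (Real.exp (-(s * x))) =
      ENNReal.ofReal (Real.exp (-(s * c)) / s) := by
  have h1 := integrableOn_exp_mul_Ioi (neg_lt_zero.2 hs) c
  have h2 := integral_exp_mul_Ioi (neg_lt_zero.2 hs) c
  simp only [neg_mul] at h1 h2
  rw [← ofReal_integral_eq_lintegral_ofReal h1 (ae_of_all _ fun x => (Real.exp_pos _).le), h2,
    neg_div_neg_eq]

lemma lintegral_Ioc_exp_neg {s u : ℝ} (hs : 0 < s) (hu : 0 ≤ u) :
    ∫⁻ x in Ioc 0 u, ENNReal.ofReal (Real.exp (-(s * x)) / s) =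
      ENNReal.ofReal ((1 - Real.exp (-(s * u))) / s ^ 2) := by
  have hcont : Continuous fun x => Real.exp (-(s * x)) / s := by fun_prop
  rw [← ofReal_integral_eq_lintegral_ofReal
    ((hcont.integrableOn_Icc (a := 0) (b := u)).mono_set Ioc_subset_Icc_self)
    (ae_of_all _ fun x => by positivity), ← intervalIntegral.integral_of_le hu]
  have := intervalIntegral.integral_eq_sub_of_hasDerivAt (a := 0) (b := u)
    (f := fun x => -Real.exp (-(s * x)) / s ^ 2) (f' := fun x => Real.exp (-(s * x)) / s)
    (fun x _ => by
      have h : HasDerivAt (fun x => -Real.exp (-(s * x)) / s ^ 2)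
          (-(Real.exp (-(s * x)) * -(s * 1)) / s ^ 2) x :=
        ((((hasDerivAt_id x).const_mul s).neg.exp).neg.div_const (s ^ 2))
      have e : Real.exp (-(s * x)) / s = -(Real.exp (-(s * x)) * -(s * 1)) / s ^ 2 := by
        field_simp
      rw [e]
      exact h)
    (hcont.intervalIntegrable _ _)
  rw [this]
  congr 1
  simp; ring

/-- The density with Laplace transform `g(s) / s²`, where `g` is a Bernstein function. -/
noncomputable def bernsteinWeight (a b : ℝ) (ρ : Measure ℝ) (x : ℝ) : ℝ≥0∞ :=
  ENNReal.ofReal (a * x + b) + ∫⁻ t, ENNReal.ofReal (min x t) ∂ρ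

lemma measurable_bernsteinWeight (a b : ℝ) (ρ : Measure ℝ) [SFinite ρ] :
    Measurable (bernsteinWeight a b ρ) := by
  unfold bernsteinWeight
  refine Measurable.add (by fun_prop) (Measurable.lintegral_prod_right' (f := fun p : ℝ × ℝ =>
    ENNReal.ofReal (min p.1 p.2)) (by fun_prop))

lemma lintegral_exp_mul_ofReal {s : ℝ} (hs : 0 < s) :
    ∫⁻ x in Ioi 0, ENNReal.ofReal (Real.exp (-(s * x))) * ENNReal.ofReal x =
      ENNReal.ofReal (1 / s ^ 2) := by
  have h := lintegral_mul_volume_inter_Iio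
    (F := fun x => ENNReal.ofReal (Real.exp (-(s * x)))) (by fun_prop) measurableSet_Ioi
    (Subset.refl (Ioi (0 : ℝ)))
  simp_rw [Ioi_inter_Iio, Real.volume_Ioo, sub_zero, lintegral_Ioi_exp_neg hs, div_eq_mul_inv,
    ENNReal.ofReal_mul (Real.exp_pos _).le] at h
  rw [h, lintegral_mul_const _ (by fun_prop), lintegral_Ioi_exp_neg hs,
    ← ENNReal.ofReal_mul (by positivity)]
  congr 1
  simp; ring

lemma lintegral_exp_mul_ofReal_min {s t : ℝ} (hs : 0 < s) (ht : 0 ≤ t) :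
    ∫⁻ x in Ioi 0, ENNReal.ofReal (Real.exp (-(s * x))) * ENNReal.ofReal (min x t) =
      ENNReal.ofReal ((1 - Real.exp (-(s * t))) / s ^ 2) := by
  have h := lintegral_mul_volume_inter_Iio
    (F := fun x => ENNReal.ofReal (Real.exp (-(s * x)))) (by fun_prop) measurableSet_Ioc
    (T := Ioc 0 t) Ioc_subset_Ioi_self
  simp_rw [volume_Ioc_inter_Iio, lintegral_Ioi_exp_neg hs] at h
  rw [h, lintegral_Ioc_exp_neg hs ht]

/-- Term by term: $a/s^2$, $b/s$ and $(1-e^{-st})/s^2$ are the Laplace transforms of $ax$, $b$ and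
$\min(x,t)$. -/
lemma HasBernsteinRepr.ofReal_div_sq_eq {f : ℝ → ℝ} {a b : ℝ} {ρ : Measure ℝ} [SFinite ρ]
    (h : HasBernsteinRepr f a b ρ) {s : ℝ} (hs : 0 < s) :
    ENNReal.ofReal (f s / s ^ 2) =
      ∫⁻ x in Ioi 0, ENNReal.ofReal (Real.exp (-(s * x))) * bernsteinWeight a b ρ x := by
  have ha := h.a_nonneg
  have hb := h.b_nonneg
  have h1 : ∫⁻ x in Ioi 0, ENNReal.ofReal (Real.exp (-(s * x))) * ENNReal.ofReal (a * x + b) =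
      ENNReal.ofReal ((a + b * s) / s ^ 2) := by
    have : ∀ x ∈ Ioi (0 : ℝ), ENNReal.ofReal (Real.exp (-(s * x))) * ENNReal.ofReal (a * x + b) =
        ENNReal.ofReal a * (ENNReal.ofReal (Real.exp (-(s * x))) * ENNReal.ofReal x) +
        ENNReal.ofReal b * ENNReal.ofReal (Real.exp (-(s * x))) := by
      intro x hx
      have hx' : 0 < x := hx
      rw [ENNReal.ofReal_add (by positivity) hb, ENNReal.ofReal_mul ha]
      ring
    rw [setLIntegral_congr_fun measurableSet_Ioi this, lintegral_add_left (by fun_prop),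
      lintegral_const_mul _ (by fun_prop), lintegral_const_mul _ (by fun_prop),
      lintegral_exp_mul_ofReal hs, lintegral_Ioi_exp_neg hs, ← ENNReal.ofReal_mul ha,
      ← ENNReal.ofReal_mul hb, ← ENNReal.ofReal_add (by positivity) (by positivity)]
    congr 1
    simp; field_simp
  have h2 : ∫⁻ x in Ioi 0, ENNReal.ofReal (Real.exp (-(s * x))) *
      ∫⁻ t, ENNReal.ofReal (min x t) ∂ρ =
      ∫⁻ t, ENNReal.ofReal ((1 - Real.exp (-(s * t))) / s ^ 2) ∂ρ := by
    have : ∀ x, ENNReal.ofReal (Real.exp (-(s * x))) * ∫⁻ t, ENNReal.ofReal (min x t) ∂ρ =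
        ∫⁻ t, ENNReal.ofReal (Real.exp (-(s * x))) * ENNReal.ofReal (min x t) ∂ρ := fun x =>
      (lintegral_const_mul _ (by fun_prop)).symm
    simp_rw [this]
    rw [lintegral_lintegral_swap (by fun_prop)]
    refine lintegral_congr_ae ?_
    filter_upwards [h.ae_pos] with t ht
    exact lintegral_exp_mul_ofReal_min hs ht.le
  unfold bernsteinWeight
  simp_rw [mul_add]
  rw [lintegral_add_left (by fun_prop), h1, h2]
  simp_rw [div_eq_mul_inv]
  have h3 : ∀ t, ENNReal.ofReal ((1 - Real.exp (-(s * t))) * (s ^ 2)⁻¹) =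
      ENNReal.ofReal (1 - Real.exp (-(s * t))) * ENNReal.ofReal (s ^ 2)⁻¹ := fun t =>
    ENNReal.ofReal_mul' (by positivity)
  simp_rw [h3]
  rw [lintegral_mul_const _ (by fun_prop), ENNReal.ofReal_mul' (p := a + b * s) (by positivity),
    ENNReal.ofReal_mul' (p := f s) (by positivity), ← add_mul, ← h.ofReal_eq hs.le]

/-- The function `μ` as an extended nonnegative number. -/
noncomputable def muENN (g : ℝ → ℝ) (u : ℝ) : ℝ≥0∞ :=
  ∫⁻ r in Ioc 0 u, ∫⁻ s in Ioi r, ENNReal.ofReal (g (max 0 s) / s ^ 2)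

variable {g : ℝ → ℝ}

lemma measurable_ofReal_div_sq (hg : MonotoneOn g (Ici 0)) :
    Measurable fun s => ENNReal.ofReal (g (max 0 s) / s ^ 2) :=
  ((measurable_comp_max_zero hg).div (by fun_prop)).ennreal_ofReal

lemma muENN_eq_lintegral_min (hg : MonotoneOn g (Ici 0)) (u : ℝ) :
    muENN g u = ∫⁻ s in Ioi 0, ENNReal.ofReal (g (max 0 s) / s ^ 2) * ENNReal.ofReal (min s u) := by
  have h := lintegral_mul_volume_inter_Iio (measurable_ofReal_div_sq hg) measurableSet_Ioc
    (T := Ioc 0 u) Ioc_subset_Ioi_self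
  simp_rw [volume_Ioc_inter_Iio] at h
  exact h.symm

lemma muENN_lower_bound (hg0 : ∀ x, 0 ≤ x → 0 ≤ g x) (hg : MonotoneOn g (Ici 0)) {s u : ℝ}
    (hs : 0 < s) (hsu : s ≤ u) : ENNReal.ofReal (g s * Real.log (u / s)) ≤ muENN g u := by
  rw [muENN_eq_lintegral_min hg]
  have hgs := hg0 s hs.le
  have hu : 0 < u := hs.trans_le hsu
  have hint : IntegrableOn (fun x : ℝ => g s * x⁻¹) (Ioc s u) := by
    refine (ContinuousOn.integrableOn_Icc ?_).mono_set Ioc_subset_Icc_self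
    exact continuousOn_const.mul (continuousOn_id.inv₀ fun x hx => (hs.trans_le hx.1).ne')
  calc ENNReal.ofReal (g s * Real.log (u / s))
      = ENNReal.ofReal (∫ x in Ioc s u, g s * x⁻¹) := by
        rw [integral_const_mul, ← intervalIntegral.integral_of_le hsu, integral_inv_of_pos hs hu]
    _ = ∫⁻ x in Ioc s u, ENNReal.ofReal (g s * x⁻¹) := by
        refine ofReal_integral_eq_lintegral_ofReal hint ?_
        filter_upwards [ae_restrict_mem measurableSet_Ioc] with x hx
        have : 0 < x := hs.trans hx.1
        positivity
    _ ≤ ∫⁻ x in Ioc s u, ENNReal.ofReal (g (max 0 x) / x ^ 2) * ENNReal.ofReal (min x u) := by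
        refine setLIntegral_mono' measurableSet_Ioc fun x hx => ?_
        have hx0 : 0 < x := hs.trans hx.1
        rw [min_eq_left hx.2, max_eq_right hx0.le, ← ENNReal.ofReal_mul' hx0.le]
        refine ENNReal.ofReal_le_ofReal ?_
        have := hg (mem_Ici.2 hs.le) (mem_Ici.2 hx0.le) hx.1.le
        calc g s * x⁻¹ ≤ g x * x⁻¹ := by gcongr
          _ = _ := by field_simp
    _ ≤ _ := lintegral_mono_set fun x hx => hs.trans hx.1

lemma muFun_eq_toReal (hg0 : ∀ x, 0 ≤ x → 0 ≤ g x) (hg : MonotoneOn g (Ici 0)) {u : ℝ}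
    (hu : 0 ≤ u) (hfin : muENN g u ≠ ∞) : muFun g u = (muENN g u).toReal := by
  have hm : Measurable fun r => ∫⁻ s in Ioi r, ENNReal.ofReal (g (max 0 s) / s ^ 2) := by
    refine Antitone.measurable fun r r' h => ?_
    exact lintegral_mono_set (Ioi_subset_Ioi h)
  rw [muFun, intervalIntegral.integral_of_le hu, muENN,
    ← integral_toReal hm.aemeasurable (ae_lt_top hm hfin)]
  refine setIntegral_congr_fun measurableSet_Ioc fun r hr => ?_
  have hr0 : 0 < r := hr.1
  have hcongr : ∀ s ∈ Ioi r, g s / s ^ 2 = g (max 0 s) / s ^ 2 := fun s hs => by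
    rw [max_eq_right (hr0.trans hs).le]
  rw [setIntegral_congr_fun measurableSet_Ioi hcongr, integral_eq_lintegral_of_nonneg_ae]
  · exact ae_of_all _ fun s => div_nonneg (hg0 _ (le_max_left _ _)) (by positivity)
  · exact ((measurable_comp_max_zero hg).div (by fun_prop)).aestronglyMeasurable

/-- Integrating $e^{-sx}$ over $s>r$ and then over $0<r\le u$ gives $(1-e^{-xu})/x^2$, so $\mu$ has
the form of a Bernstein function. -/
lemma HasBernsteinRepr.muENN_eq {a b : ℝ} {ρ : Measure ℝ} [SFinite ρ]
    (h : HasBernsteinRepr g a b ρ) {u : ℝ} (hu : 0 ≤ u) :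
    muENN g u = ∫⁻ x in Ioi 0,
      ENNReal.ofReal ((1 - Real.exp (-(x * u))) / x ^ 2) * bernsteinWeight a b ρ x := by
  have hw := measurable_bernsteinWeight a b ρ
  have h1 : ∀ r ∈ Ioc 0 u, ∫⁻ s in Ioi r, ENNReal.ofReal (g (max 0 s) / s ^ 2) =
      ∫⁻ x in Ioi 0, ENNReal.ofReal (Real.exp (-(x * r)) / x) * bernsteinWeight a b ρ x := by
    intro r hr
    have h2 : ∀ s ∈ Ioi r, ENNReal.ofReal (g (max 0 s) / s ^ 2) =
        ∫⁻ x in Ioi 0, ENNReal.ofReal (Real.exp (-(s * x))) * bernsteinWeight a b ρ x := by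
      intro s hs
      have hs0 : 0 < s := hr.1.trans hs
      rw [max_eq_right hs0.le, h.ofReal_div_sq_eq hs0]
    rw [setLIntegral_congr_fun measurableSet_Ioi h2,
      lintegral_lintegral_swap (f := fun s x =>
        ENNReal.ofReal (Real.exp (-(s * x))) * bernsteinWeight a b ρ x) (Measurable.aemeasurable
        (Measurable.mul (by fun_prop) (hw.comp measurable_snd)))]
    refine setLIntegral_congr_fun measurableSet_Ioi fun x hx => ?_
    rw [lintegral_mul_const _ (by fun_prop)]
    simp_rw [mul_comm _ x]
    rw [lintegral_Ioi_exp_neg hx]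
  rw [muENN, setLIntegral_congr_fun measurableSet_Ioc h1,
    lintegral_lintegral_swap (f := fun r x =>
      ENNReal.ofReal (Real.exp (-(x * r)) / x) * bernsteinWeight a b ρ x) (Measurable.aemeasurable
        (Measurable.mul (by fun_prop) (hw.comp measurable_snd)))]
  refine setLIntegral_congr_fun measurableSet_Ioi fun x hx => ?_
  rw [lintegral_mul_const _ (by fun_prop), lintegral_Ioc_exp_neg hx hu]

/-- Polar coordinates followed by $s=r^{-2}$ turn the Lévy condition on $\mathbb R^n$ into a
one-dimensional condition on `g`, free of `n`. -/
lemma integrableOn_min_inv_mul {n : ℕ} (hn : 1 ≤ n) (hg0 : ∀ x, 0 ≤ x → 0 ≤ g x)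
    (hg : MonotoneOn g (Ici 0)) (hν : ∫⁻ y : EuclideanSpace ℝ (Fin n),
      ENNReal.ofReal (min 1 (‖y‖ ^ 2) * jumpDensity g y) < ∞) :
    IntegrableOn (fun s => min 1 s⁻¹ * g s * s⁻¹) (Ioi 0) := by
  have : Nonempty (Fin n) := ⟨⟨0, hn⟩⟩
  have h1 : Integrable fun y : EuclideanSpace ℝ (Fin n) => min 1 (‖y‖ ^ 2) * jumpDensity g y := by
    refine (lintegral_ofReal_ne_top_iff_integrable
      (Measurable.mul (by fun_prop) (measurable_jumpDensity hg)).aestronglyMeasurable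
      (ae_of_all _ fun y => ?_)).1 hν.ne
    exact mul_nonneg (by positivity) (jumpDensity_nonneg hg0 y)
  have h2 := (integrable_fun_norm_addHaar (volume : Measure (EuclideanSpace ℝ (Fin n)))
    (f := fun r => min 1 (r ^ 2) * (g (1 / r ^ 2) / r ^ n))).1 h1
  rw [finrank_euclideanSpace_fin] at h2
  rw [← integrableOn_Ioi_comp_rpow_iff _ (p := -2) (by norm_num)]
  refine (IntegrableOn.congr_fun (h2.const_mul 2) (fun r hr => ?_) measurableSet_Ioi)
  have hr0 : 0 < r := hr
  have e1 : r ^ (-2 : ℝ) = (r ^ 2)⁻¹ := by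
    rw [Real.rpow_neg hr0.le]; norm_cast
  have e2 : r ^ (-2 - 1 : ℝ) = (r ^ 3)⁻¹ := by
    rw [show (-2 - 1 : ℝ) = -(3 : ℕ) by norm_num, Real.rpow_neg hr0.le, Real.rpow_natCast]
  simp only [smul_eq_mul, e1, e2, inv_inv]
  -- The polar factor is $r^{n-1}$ with natural-number subtraction, so `n` is written as a
  -- successor.
  obtain ⟨m, rfl⟩ : ∃ m, n = m + 1 := ⟨n - 1, by omega⟩
  rw [Nat.add_sub_cancel, pow_succ, one_div]
  rw [show |(-2 : ℝ)| = 2 by norm_num]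
  field_simp
  ring

lemma muENN_ne_top {n : ℕ} (hn : 1 ≤ n) (hg0 : ∀ x, 0 ≤ x → 0 ≤ g x)
    (hg : MonotoneOn g (Ici 0)) (hν : ∫⁻ y : EuclideanSpace ℝ (Fin n),
      ENNReal.ofReal (min 1 (‖y‖ ^ 2) * jumpDensity g y) < ∞) (u : ℝ) : muENN g u ≠ ∞ := by
  have hint := (integrableOn_min_inv_mul hn hg0 hg hν).lintegral_lt_top
  rw [muENN_eq_lintegral_min hg]
  refine (lt_of_le_of_lt ?_ (ENNReal.mul_lt_top (ENNReal.ofReal_lt_top (r := max 1 u)) hint)).ne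
  rw [← lintegral_const_mul' _ _ ENNReal.ofReal_ne_top]
  refine setLIntegral_mono' measurableSet_Ioi fun s hs => ?_
  have hs0 : 0 < s := hs
  have hgs := hg0 s hs0.le
  rw [max_eq_right hs0.le, ← ENNReal.ofReal_mul (by positivity), ← ENNReal.ofReal_mul (by positivity)]
  refine ENNReal.ofReal_le_ofReal ?_
  have hmin : min s u ≤ max 1 u * (s * min 1 s⁻¹) := by
    rcases le_total 1 s with h | h
    · rw [min_eq_right (inv_le_one_of_one_le₀ h), mul_inv_cancel₀ hs0.ne', mul_one]
      exact (min_le_right _ _).trans (le_max_right _ _)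
    · rw [min_eq_left ((one_le_inv₀ hs0).2 h), mul_one]
      refine (min_le_left _ _).trans ?_
      nlinarith [le_max_left 1 u]
  calc g s / s ^ 2 * min s u ≤ g s / s ^ 2 * (max 1 u * (s * min 1 s⁻¹)) := by gcongr
    _ = _ := by field_simp

end Mu

/-! ### Heat kernels and the Lévy density for $\mu(|\xi|^2)$ -/

section HeatKernel

variable {n : ℕ}

/-- The density of the centred Gaussian law with characteristic function `e^{-x|ξ|²}`. -/
noncomputable def heatKernel (x : ℝ) (y : EuclideanSpace ℝ (Fin n)) : ℝ :=
  Real.exp (-(4 * x)⁻¹ * ‖y‖ ^ 2) / (Real.pi / (4 * x)⁻¹) ^ ((n : ℝ) / 2)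

lemma integral_exp_neg_mul_sq_mul_cos {b : ℝ} (hb : 0 < b) (ξ : EuclideanSpace ℝ (Fin n)) :
    ∫ y, Real.exp (-b * ‖y‖ ^ 2) * Real.cos (inner ℝ ξ y) =
      (Real.pi / b) ^ ((n : ℝ) / 2) * Real.exp (-‖ξ‖ ^ 2 / (4 * b)) := by
  have hb' : 0 < (b : ℂ).re := hb
  have h := GaussianFourier.integral_cexp_neg_mul_sq_norm_add hb' Complex.I ξ
  have hint := GaussianFourier.integrable_cexp_neg_mul_sq_norm_add hb' Complex.I ξ
  have h2 := integral_re hint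
  simp only [RCLike.re_to_complex] at h2
  have h3 : ∀ y : EuclideanSpace ℝ (Fin n),
      (Complex.exp (-(b : ℂ) * (‖y‖ : ℂ) ^ 2 + Complex.I * ((inner ℝ ξ y : ℝ) : ℂ))).re =
      Real.exp (-b * ‖y‖ ^ 2) * Real.cos (inner ℝ ξ y) := by
    intro y
    rw [Complex.exp_re]
    congr 2
    · simp [← Complex.ofReal_pow]
    · simp [← Complex.ofReal_pow]
  simp_rw [h3] at h2
  rw [h2, h, finrank_euclideanSpace_fin]
  have h4 : ((Real.pi : ℂ) / b) ^ ((n : ℂ) / 2) * Complex.exp (Complex.I ^ 2 * (‖ξ‖ : ℂ) ^ 2 /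
      (4 * b)) = (((Real.pi / b) ^ ((n : ℝ) / 2) * Real.exp (-‖ξ‖ ^ 2 / (4 * b)) : ℝ) : ℂ) := by
    rw [Complex.ofReal_mul, Complex.ofReal_cpow (by positivity), Complex.I_sq]
    push_cast
    simp
  rw [h4, Complex.ofReal_re]

lemma heatKernel_nonneg {x : ℝ} (hx : 0 < x) (y : EuclideanSpace ℝ (Fin n)) :
    0 ≤ heatKernel x y := by
  have := Real.pi_pos
  unfold heatKernel; positivity

lemma measurable_heatKernel :
    Measurable fun p : ℝ × EuclideanSpace ℝ (Fin n) => heatKernel p.1 p.2 := by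
  unfold heatKernel; fun_prop

lemma lintegral_cos_mul_heatKernel {x : ℝ} (hx : 0 < x) (ξ : EuclideanSpace ℝ (Fin n)) :
    ∫⁻ y, ENNReal.ofReal (1 - Real.cos (inner ℝ ξ y)) * ENNReal.ofReal (heatKernel x y) =
      ENNReal.ofReal (1 - Real.exp (-(x * ‖ξ‖ ^ 2))) := by
  have hb : 0 < (4 * x)⁻¹ := by positivity
  have hc : 0 < (Real.pi / (4 * x)⁻¹) ^ ((n : ℝ) / 2) := by
    have := Real.pi_pos
    positivity
  have hi1 : Integrable fun y : EuclideanSpace ℝ (Fin n) => Real.exp (-(4 * x)⁻¹ * ‖y‖ ^ 2) := by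
    have hb' : 0 < (((4 * x)⁻¹ : ℝ) : ℂ).re := hb
    have h := (GaussianFourier.integrable_cexp_neg_mul_sq_norm_add hb' 0
      (0 : EuclideanSpace ℝ (Fin n))).re
    refine h.congr (ae_of_all _ fun y => ?_)
    simp only [RCLike.re_to_complex, zero_mul, add_zero]
    rw [← Complex.ofReal_pow, ← Complex.ofReal_neg, ← Complex.ofReal_mul, ← Complex.ofReal_exp,
      Complex.ofReal_re]
  have hi2 : Integrable fun y : EuclideanSpace ℝ (Fin n) =>
      Real.exp (-(4 * x)⁻¹ * ‖y‖ ^ 2) * Real.cos (inner ℝ ξ y) := by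
    refine hi1.mono (by fun_prop) (ae_of_all _ fun y => ?_)
    rw [norm_mul]
    exact mul_le_of_le_one_right (norm_nonneg _) (Real.abs_cos_le_one _)
  have h1 := integral_exp_neg_mul_sq_mul_cos hb (0 : EuclideanSpace ℝ (Fin n))
  have h2 := integral_exp_neg_mul_sq_mul_cos hb ξ
  simp only [inner_zero_left, Real.cos_zero, mul_one, norm_zero] at h1
  have heq : ∀ y : EuclideanSpace ℝ (Fin n), (1 - Real.cos (inner ℝ ξ y)) * heatKernel x y =
      (Real.exp (-(4 * x)⁻¹ * ‖y‖ ^ 2) -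
        Real.exp (-(4 * x)⁻¹ * ‖y‖ ^ 2) * Real.cos (inner ℝ ξ y)) /
          (Real.pi / (4 * x)⁻¹) ^ ((n : ℝ) / 2) := by
    intro y; unfold heatKernel; ring
  have hval : ∫ y, (1 - Real.cos (inner ℝ ξ y)) * heatKernel x y =
      1 - Real.exp (-(x * ‖ξ‖ ^ 2)) := by
    simp_rw [heq]
    rw [integral_div, integral_sub hi1 hi2, h1, h2, ← mul_sub, mul_div_cancel_left₀ _ hc.ne']
    congr 1
    · simp
    · congr 1; field_simp
  rw [← hval, ofReal_integral_eq_lintegral_ofReal]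
  · refine lintegral_congr fun y => ?_
    rw [ENNReal.ofReal_mul (sub_nonneg.2 (Real.cos_le_one _))]
  · simp_rw [heq]
    exact (hi1.sub hi2).div_const _
  · exact ae_of_all _ fun y =>
      mul_nonneg (sub_nonneg.2 (Real.cos_le_one _)) (heatKernel_nonneg hx y)

/-- The jump density of the Lévy process with symbol `μ(|ξ|²)`. -/
noncomputable def muJumpDensity (a b : ℝ) (ρ : Measure ℝ) (y : EuclideanSpace ℝ (Fin n)) : ℝ≥0∞ :=
  ∫⁻ x in Ioi 0, ENNReal.ofReal (1 / x ^ 2) * bernsteinWeight a b ρ x *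
    ENNReal.ofReal (heatKernel x y)

lemma muJumpDensity_neg (a b : ℝ) (ρ : Measure ℝ) (y : EuclideanSpace ℝ (Fin n)) :
    muJumpDensity a b ρ (-y) = muJumpDensity a b ρ y := by
  simp [muJumpDensity, heatKernel]

lemma measurable_muJumpDensity_integrand (a b : ℝ) (ρ : Measure ℝ) [SFinite ρ] :
    Measurable fun p : EuclideanSpace ℝ (Fin n) × ℝ => ENNReal.ofReal (1 / p.2 ^ 2) *
      bernsteinWeight a b ρ p.2 * ENNReal.ofReal (heatKernel p.2 p.1) := by
  refine Measurable.mul (Measurable.mul (by fun_prop)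
    ((measurable_bernsteinWeight a b ρ).comp measurable_snd)) ?_
  exact (measurable_heatKernel.comp measurable_swap).ennreal_ofReal

lemma measurable_muJumpDensity (a b : ℝ) (ρ : Measure ℝ) [SFinite ρ] :
    Measurable (muJumpDensity a b ρ : EuclideanSpace ℝ (Fin n) → ℝ≥0∞) :=
  (measurable_muJumpDensity_integrand a b ρ).lintegral_prod_right'

/-- Subordination: by Tonelli the cosine integral falls on each heat kernel, giving
$1-e^{-x|\xi|^2}$, and the mixture is then $\mu$ at $|\xi|^2$. -/
lemma HasBernsteinRepr.lintegral_cos_mul_muJumpDensity {g : ℝ → ℝ} {a b : ℝ} {ρ : Measure ℝ}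
    [SFinite ρ] (h : HasBernsteinRepr g a b ρ) (ξ : EuclideanSpace ℝ (Fin n)) :
    ∫⁻ y, ENNReal.ofReal (1 - Real.cos (inner ℝ ξ y)) * muJumpDensity a b ρ y =
      muENN g (‖ξ‖ ^ 2) := by
  have hw := measurable_bernsteinWeight a b ρ
  have hm := measurable_muJumpDensity_integrand (n := n) a b ρ
  have h1 : ∀ y, ENNReal.ofReal (1 - Real.cos (inner ℝ ξ y)) * muJumpDensity a b ρ y =
      ∫⁻ x in Ioi 0, ENNReal.ofReal (1 - Real.cos (inner ℝ ξ y)) * (ENNReal.ofReal (1 / x ^ 2) *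
        bernsteinWeight a b ρ x * ENNReal.ofReal (heatKernel x y)) := fun y =>
    (lintegral_const_mul _ (hm.comp measurable_prodMk_left)).symm
  simp_rw [h1]
  rw [lintegral_lintegral_swap (f := fun y x => ENNReal.ofReal (1 - Real.cos (inner ℝ ξ y)) *
    (ENNReal.ofReal (1 / x ^ 2) * bernsteinWeight a b ρ x * ENNReal.ofReal (heatKernel x y)))
    (Measurable.mul (by fun_prop) hm).aemeasurable, h.muENN_eq (by positivity)]
  refine setLIntegral_congr_fun measurableSet_Ioi fun x hx => ?_
  have hx0 : 0 < x := hx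
  have h2 : ∀ y : EuclideanSpace ℝ (Fin n), ENNReal.ofReal (1 - Real.cos (inner ℝ ξ y)) *
      (ENNReal.ofReal (1 / x ^ 2) * bernsteinWeight a b ρ x * ENNReal.ofReal (heatKernel x y)) =
      ENNReal.ofReal (1 / x ^ 2) * bernsteinWeight a b ρ x *
      (ENNReal.ofReal (1 - Real.cos (inner ℝ ξ y)) * ENNReal.ofReal (heatKernel x y)) := by
    intro y; ring
  simp_rw [h2]
  have hmk : Measurable fun y : EuclideanSpace ℝ (Fin n) => heatKernel x y :=
    measurable_heatKernel.comp measurable_prodMk_left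
  have hmul : Measurable fun y : EuclideanSpace ℝ (Fin n) =>
      ENNReal.ofReal (1 - Real.cos (inner ℝ ξ y)) * ENNReal.ofReal (heatKernel x y) :=
    Measurable.mul (by fun_prop) hmk.ennreal_ofReal
  rw [lintegral_const_mul _ hmul, lintegral_cos_mul_heatKernel hx0, mul_right_comm, ← ENNReal.ofReal_mul (by positivity)]
  congr 2
  ring

end HeatKernel

/-! ### From the logarithmic lower bound to the density bound -/

section Density

variable {n : ℕ} {g : ℝ → ℝ}

/-- The constant in the bound of the transition density in dimension `n`. -/
noncomputable def densityConst (n : ℕ) : ℝ :=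
  2 ^ n * (∫ η : EuclideanSpace ℝ (Fin n), ((1 : ℝ) + ‖η‖ ^ 2) ^ (-(n : ℝ))) + 1

/-- The summand `1` gives positivity without showing that the integral is nonzero. -/
lemma densityConst_pos (n : ℕ) : 0 < densityConst n := by
  have : 0 ≤ ∫ η : EuclideanSpace ℝ (Fin n), ((1 : ℝ) + ‖η‖ ^ 2) ^ (-(n : ℝ)) :=
    integral_nonneg fun η => by positivity
  unfold densityConst; positivity

/-- For $z\ge1$ the left side is at most $z^{-n}\le(2/(1+z))^n$; for $z<1$ the right side is at
least $1$. -/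
lemma exp_neg_le_of_log_le {z x : ℝ} (hz : 0 ≤ z) (hx : 0 ≤ x)
    (h : 1 ≤ z → n * Real.log z ≤ x) : Real.exp (-x) ≤ 2 ^ n * (1 + z) ^ (-(n : ℝ)) := by
  rw [Real.rpow_neg (by positivity), Real.rpow_natCast, ← div_eq_mul_inv, ← div_pow]
  rcases le_or_gt 1 z with h1 | h1
  · have hz0 : 0 < z := lt_of_lt_of_le one_pos h1
    calc Real.exp (-x) ≤ Real.exp (-(n * Real.log z)) := by
          gcongr; exact h h1
      _ = (1 / z) ^ n := by
          rw [Real.exp_neg, Real.exp_nat_mul, Real.exp_log hz0, one_div, inv_pow]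
      _ ≤ (2 / (1 + z)) ^ n := by
          gcongr ?_ ^ n
          rw [div_le_div_iff₀ hz0 (by positivity)]
          linarith
  · calc Real.exp (-x) ≤ 1 := Real.exp_le_one_iff.2 (by linarith)
      _ ≤ (2 / (1 + z)) ^ n := by
          refine one_le_pow₀ ?_
          rw [le_div_iff₀ (by positivity)]
          linarith

/-- The integrand decays like $|\xi|^{-2n}$, and $2n>n$. The dilation by $\sqrt s$ is the source of
the power $s^{n/2}$. -/
lemma integral_japanese_scaled (hn : 1 ≤ n) {s : ℝ} (hs : 0 < s) :
    Integrable (fun ξ : EuclideanSpace ℝ (Fin n) => (1 + ‖ξ‖ ^ 2 / s) ^ (-(n : ℝ))) ∧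
    ∫ ξ : EuclideanSpace ℝ (Fin n), (1 + ‖ξ‖ ^ 2 / s) ^ (-(n : ℝ)) =
      s ^ ((n : ℝ) / 2) * ∫ η : EuclideanSpace ℝ (Fin n), ((1 : ℝ) + ‖η‖ ^ 2) ^ (-(n : ℝ)) := by
  have hn0 : (0 : ℝ) < n := by exact_mod_cast hn
  have hr : 0 < (Real.sqrt s)⁻¹ := inv_pos.2 (Real.sqrt_pos.2 hs)
  have hf : ∀ ξ : EuclideanSpace ℝ (Fin n), (1 + ‖ξ‖ ^ 2 / s) ^ (-(n : ℝ)) =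
      ((1 : ℝ) + ‖(Real.sqrt s)⁻¹ • ξ‖ ^ 2) ^ (-(n : ℝ)) := by
    intro ξ
    rw [norm_smul, mul_pow, norm_inv, Real.norm_of_nonneg (Real.sqrt_nonneg s), inv_pow,
      Real.sq_sqrt hs.le, inv_mul_eq_div]
  have hi : Integrable (fun η : EuclideanSpace ℝ (Fin n) => ((1 : ℝ) + ‖η‖ ^ 2) ^ (-(n : ℝ))) := by
    have := integrable_rpow_neg_one_add_norm_sq (E := EuclideanSpace ℝ (Fin n)) (μ := volume)
      (r := 2 * n) (by rw [finrank_euclideanSpace_fin]; linarith)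
    convert this using 3
    ring
  simp_rw [hf]
  refine ⟨hi.comp_smul hr.ne', ?_⟩
  rw [Measure.integral_comp_smul_of_nonneg volume
    (fun η : EuclideanSpace ℝ (Fin n) => ((1 : ℝ) + ‖η‖ ^ 2) ^ (-(n : ℝ))) _ (hR := hr.le),
    finrank_euclideanSpace_fin, smul_eq_mul, inv_pow, inv_inv]
  congr 1
  rw [Real.sqrt_eq_rpow, ← Real.rpow_natCast, ← Real.rpow_mul hs.le]
  congr 1; ring

lemma measure_le_of_symbol_lower_bound (hn : 1 ≤ n) {P : Measure (EuclideanSpace ℝ (Fin n))}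
    [IsProbabilityMeasure P] {ψ : EuclideanSpace ℝ (Fin n) → ℝ} (hψ : ∀ ξ, 0 ≤ ψ ξ)
    (hP : ∀ ξ, charFun P ξ = ((Real.exp (-ψ ξ) : ℝ) : ℂ)) {s : ℝ} (hs : 0 < s)
    (hlow : ∀ ξ, s ≤ ‖ξ‖ ^ 2 → n * Real.log (‖ξ‖ ^ 2 / s) ≤ ψ ξ) :
    P ≤ (ENNReal.ofReal (densityConst n) * ENNReal.ofReal s ^ ((n : ℝ) / 2)) • volume := by
  obtain ⟨hi, hval⟩ := integral_japanese_scaled hn hs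
  have hbd : ∀ ξ : EuclideanSpace ℝ (Fin n), ‖charFun P (-(2 * Real.pi) • ξ)‖ ≤
      2 ^ n * (1 + ‖ξ‖ ^ 2 / s) ^ (-(n : ℝ)) := by
    intro ξ
    set η := -(2 * Real.pi) • ξ
    -- Since $2\pi\ge1$, the dilation of the frequency only improves the decay and can be dropped.
    have hη : ‖ξ‖ ^ 2 ≤ ‖η‖ ^ 2 := by
      rw [norm_smul, norm_neg, Real.norm_of_nonneg (by positivity)]
      have : 1 ≤ 2 * Real.pi := by linarith [Real.pi_gt_three]
      gcongr
      nlinarith [norm_nonneg ξ]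
    rw [hP, Complex.norm_real, Real.norm_of_nonneg (Real.exp_pos _).le]
    refine (exp_neg_le_of_log_le (n := n) (z := ‖η‖ ^ 2 / s) (by positivity) (hψ η)
      fun h => hlow η ((one_le_div hs).1 h)).trans ?_
    gcongr ?_ * ?_
    refine Real.rpow_le_rpow_of_nonpos (by positivity) (by gcongr) (by simp)
  have hint : Integrable fun ξ : EuclideanSpace ℝ (Fin n) => charFun P (-(2 * Real.pi) • ξ) := by
    refine (hi.const_mul (2 ^ n)).mono' ?_ (ae_of_all _ hbd)
    exact (measurable_charFun.comp (measurable_const_smul _)).aestronglyMeasurable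
  have hM : ∫ ξ : EuclideanSpace ℝ (Fin n), ‖charFun P (-(2 * Real.pi) • ξ)‖ ≤
      densityConst n * s ^ ((n : ℝ) / 2) := by
    refine (integral_mono hint.norm (hi.const_mul (2 ^ n)) hbd).trans ?_
    rw [integral_const_mul, hval, densityConst, add_mul]
    have : 0 < s ^ ((n : ℝ) / 2) := by positivity
    nlinarith
  have := measure_le_of_integrable_charFun hint hM
  rwa [ENNReal.ofReal_mul (densityConst_pos n).le,
    ← ENNReal.ofReal_rpow_of_nonneg hs.le (by positivity)] at this

lemma rnDeriv_le_of_le_smul {α : Type*} [MeasurableSpace α] {μ P : Measure α} [SigmaFinite μ]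
    {K : ℝ≥0∞} (h : P ≤ K • μ) : ∀ᵐ x ∂μ, P.rnDeriv μ x ≤ K := by
  refine ae_le_of_forall_setLIntegral_le_of_sigmaFinite (Measure.measurable_rnDeriv _ _)
    fun A _ _ => ?_
  rw [setLIntegral_const]
  exact (Measure.setLIntegral_rnDeriv_le A).trans (h A)

lemma le_of_genInv_lt (hg : MonotoneOn g (Ici 0)) {u s : ℝ}
    (h : genInv g u < ENNReal.ofReal s) : u ≤ g s := by
  obtain ⟨r, ⟨s', hs', hus', rfl⟩, hr⟩ := sInf_lt_iff.1 h
  have hlt : s' < s := (ENNReal.ofReal_lt_ofReal_iff_of_nonneg hs').1 hr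
  exact hus'.trans (hg (mem_Ici.2 hs') (mem_Ici.2 (hs'.trans hlt.le)) hlt.le)

/-- The level is known to be reached only strictly above the generalised inverse, so the bound is
taken along a sequence decreasing to `v`; for `v = ∞` it is void. -/
lemma ae_le_of_forall_genInv_lt {α : Type*} [MeasurableSpace α] {μ : Measure α} {f : α → ℝ≥0∞}
    {c v : ℝ≥0∞} (hc : c ≠ 0) (hc' : c ≠ ∞) {p : ℝ} (hp : 0 < p)
    (h : ∀ s : ℝ, 0 < s → v < ENNReal.ofReal s → ∀ᵐ x ∂μ, f x ≤ c * ENNReal.ofReal s ^ p) :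
    ∀ᵐ x ∂μ, f x ≤ c * v ^ p := by
  rcases eq_or_ne v ∞ with rfl | hv
  · rw [ENNReal.top_rpow_of_pos hp, ENNReal.mul_top hc]
    exact ae_of_all _ fun x => le_top
  · obtain ⟨u, -, hu, hlim⟩ := exists_seq_strictAnti_tendsto' (lt_top_iff_ne_top.2 hv)
    have hall : ∀ᵐ x ∂μ, ∀ k, f x ≤ c * u k ^ p := by
      refine ae_all_iff.2 fun k => ?_
      have := h (u k).toReal (ENNReal.toReal_pos ((zero_le.trans_lt (hu k).1).ne') (hu k).2.ne)
      rw [ENNReal.ofReal_toReal (hu k).2.ne] at this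
      exact this (hu k).1
    filter_upwards [hall] with x hx
    refine ge_of_tendsto' (f := fun k => c * u k ^ p) (x := atTop) ?_ hx
    exact ENNReal.Tendsto.const_mul ((ENNReal.continuous_rpow_const.tendsto v).comp hlim)
      (Or.inr hc')

/-- A symmetric infinitely divisible law, with absolutely continuous Lévy measure and symbol
bounded below by a logarithm at the scale of `g`, has a density bounded in terms of the inverse
of `g`. -/
theorem exists_bounded_density (hn : 1 ≤ n) (hg : MonotoneOn g (Ici 0))
    (hg1 : ∃ s, 0 < s ∧ 0 < g s) {κ : ℝ} (hκ : 0 < κ)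
    {j : EuclideanSpace ℝ (Fin n) → ℝ≥0∞} (hjm : Measurable j) (hj : ∀ y, j (-y) = j y)
    (hfin : ∀ ξ, ∫⁻ y, ENNReal.ofReal (1 - Real.cos (inner ℝ ξ y)) * j y ≠ ∞)
    (hlow : ∀ s ξ, 0 < s → s ≤ ‖ξ‖ ^ 2 → ENNReal.ofReal (κ * g s * Real.log (‖ξ‖ ^ 2 / s)) ≤
      ∫⁻ y, ENNReal.ofReal (1 - Real.cos (inner ℝ ξ y)) * j y)
    {P : Measure (EuclideanSpace ℝ (Fin n))} [IsProbabilityMeasure P] {t : ℝ} (ht : 0 < t)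
    (hP : ∀ ξ, charFun P ξ = ((Real.exp
      (-(t * (∫⁻ y, ENNReal.ofReal (1 - Real.cos (inner ℝ ξ y)) * j y).toReal)) : ℝ) : ℂ)) :
    ∃ p : EuclideanSpace ℝ (Fin n) → ℝ, Measurable p ∧ (∀ x, 0 ≤ p x) ∧
      P = volume.withDensity (fun x => ENNReal.ofReal (p x)) ∧
      ∀ x, ENNReal.ofReal (p x) ≤
        ENNReal.ofReal (densityConst n) * genInv g (1 / (κ / n * t)) ^ ((n : ℝ) / 2) := by
  have hn0 : (0 : ℝ) < n := by exact_mod_cast hn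
  have : Nonempty (Fin n) := ⟨⟨0, hn⟩⟩
  set Φ : EuclideanSpace ℝ (Fin n) → ℝ≥0∞ := fun ξ =>
    ∫⁻ y, ENNReal.ofReal (1 - Real.cos (inner ℝ ξ y)) * j y with hΦ
  have hlow' : ∀ s ξ, 0 < s → s ≤ ‖ξ‖ ^ 2 → κ * g s * Real.log (‖ξ‖ ^ 2 / s) ≤ (Φ ξ).toReal :=
    fun s ξ hs hsξ => (ENNReal.ofReal_le_iff_le_toReal (hfin ξ)).1 (hlow s ξ hs hsξ)
  have hinf : ∫⁻ y, j y = ∞ := by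
    by_contra hJ
    obtain ⟨s, hs, hgs⟩ := hg1
    have hle : ∀ ξ, (Φ ξ).toReal ≤ 2 * (∫⁻ y, j y).toReal := by
      intro ξ
      rw [show (2 : ℝ) = (2 : ℝ≥0∞).toReal by simp, ← ENNReal.toReal_mul]
      refine ENNReal.toReal_mono (ENNReal.mul_ne_top (by simp) hJ) ?_
      rw [← lintegral_const_mul _ hjm]
      refine lintegral_mono fun y => ?_
      gcongr
      refine ENNReal.ofReal_le_of_le_toReal ?_
      rw [ENNReal.toReal_ofNat]
      linarith [Real.neg_one_le_cos (inner ℝ ξ y)]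
    -- A finite Lévy mass $J$ bounds the symbol by $2J$. With $|\xi|^2=se^X$ the logarithmic bound
    -- gives $2J+1$, a contradiction.
    set X := (2 * (∫⁻ y, j y).toReal + 1) / (κ * g s)
    have hX : 0 ≤ X := by positivity
    obtain ⟨ξ, hξ⟩ := exists_norm_eq (EuclideanSpace ℝ (Fin n))
      (Real.sqrt_nonneg (s * Real.exp X))
    have hsq : ‖ξ‖ ^ 2 = s * Real.exp X := by rw [hξ, Real.sq_sqrt (by positivity)]
    have h1 := hlow' s ξ hs (by
      rw [hsq]; exact le_mul_of_one_le_right hs.le (Real.one_le_exp hX))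
    rw [hsq, mul_div_cancel_left₀ _ hs.ne', Real.log_exp, mul_div_cancel₀ _ (by positivity)] at h1
    linarith [hle ξ]
  have hac : P ≪ volume := by
    have htj : ∀ ξ : EuclideanSpace ℝ (Fin n), ∫⁻ y, ENNReal.ofReal (1 - Real.cos (inner ℝ ξ y)) *
        (ENNReal.ofReal t * j y) = ENNReal.ofReal t * Φ ξ := by
      intro ξ
      have hm : Measurable fun y => ENNReal.ofReal (1 - Real.cos (inner ℝ ξ y)) * j y :=
        Measurable.mul (by fun_prop) hjm
      simp only [hΦ]
      rw [← lintegral_const_mul _ hm]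
      refine lintegral_congr fun y => by ring
    refine absolutelyContinuous_of_charFun (j := fun y => ENNReal.ofReal t * j y)
      (hjm.const_mul _) (fun y => by rw [hj]) (fun ξ => ?_) ?_ fun ξ => ?_
    · rw [htj]; exact ENNReal.mul_ne_top ENNReal.ofReal_ne_top (hfin ξ)
    · rw [lintegral_const_mul _ hjm, hinf, ENNReal.mul_top (by simpa using ht)]
    · rw [htj, hP, ENNReal.toReal_mul, ENNReal.toReal_ofReal ht.le]
  set B := ENNReal.ofReal (densityConst n) * genInv g (1 / (κ / n * t)) ^ ((n : ℝ) / 2) with hB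
  have hbound : ∀ᵐ x, P.rnDeriv volume x ≤ B := by
    refine ae_le_of_forall_genInv_lt (by simpa using densityConst_pos n) ENNReal.ofReal_ne_top
      (by positivity) fun s hs hvs => ?_
    have hgs := le_of_genInv_lt hg hvs
    refine rnDeriv_le_of_le_smul (measure_le_of_symbol_lower_bound hn
      (fun ξ => mul_nonneg ht.le ENNReal.toReal_nonneg) hP hs fun ξ hsξ => ?_)
    have h1 := hlow' s ξ hs hsξ
    have hlog : 0 ≤ Real.log (‖ξ‖ ^ 2 / s) := Real.log_nonneg ((one_le_div hs).2 hsξ)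
    have h2 : (n : ℝ) ≤ t * (κ * g s) := by
      rw [div_le_iff₀ (by positivity)] at hgs
      calc (n : ℝ) ≤ n * (g s * (κ / n * t)) := le_mul_of_one_le_right hn0.le hgs
        _ = t * (κ * g s) := by field_simp
    calc n * Real.log (‖ξ‖ ^ 2 / s) ≤ t * (κ * g s) * Real.log (‖ξ‖ ^ 2 / s) := by gcongr
      _ = t * (κ * g s * Real.log (‖ξ‖ ^ 2 / s)) := by ring
      _ ≤ _ := by gcongr
  -- Cutting at `B` changes the density only on a null set and makes the bound hold at every point.
  refine ⟨fun x => (min (P.rnDeriv volume x) B).toReal,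
    ((Measure.measurable_rnDeriv _ _).min measurable_const).ennreal_toReal,
    fun x => ENNReal.toReal_nonneg, ?_, fun x => ENNReal.ofReal_toReal_le.trans (min_le_right _ _)⟩
  conv_lhs => rw [← Measure.withDensity_rnDeriv_eq P volume hac]
  refine withDensity_congr_ae ?_
  filter_upwards [hbound, Measure.rnDeriv_lt_top P volume] with x hx hx'
  rw [min_eq_left hx, ENNReal.ofReal_toReal hx'.ne]

end Density

/-! ### Assembly for the two symbols -/

theorem lemma2p3 (n : ℕ) (hn : 1 ≤ n) (g : ℝ → ℝ) (hg : IsCompleteBernstein g)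
    (hg0 : ∃ s, 0 < s ∧ g s ≠ 0)
    (hν : ∫⁻ y : EuclideanSpace ℝ (Fin n),
      ENNReal.ofReal (min 1 (‖y‖ ^ 2) * jumpDensity g y) < ∞) :
    ∃ c γ : ℝ, 0 < c ∧ 0 < γ ∧
      ∀ (Ω : Type*) [MeasurableSpace Ω] (P : Measure Ω) [IsProbabilityMeasure P]
        (X : ℝ≥0 → Ω → EuclideanSpace ℝ (Fin n)),
        IsLevyProcess P X →
        (HasSymbol P X (psiInfty g) ∨ HasSymbol P X (fun ξ => muFun g (‖ξ‖ ^ 2))) →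
        ∃ p : ℝ≥0 → EuclideanSpace ℝ (Fin n) → ℝ,
          IsTransitionDensity P X p ∧
          ∀ t, 0 < t → ∀ x, ENNReal.ofReal (p t x) ≤
            ENNReal.ofReal c * genInv g (1 / (γ * (t : ℝ))) ^ ((n : ℝ) / 2) := by
  obtain ⟨a, b, ρ, hρ, hrep⟩ : ∃ a b ρ, SFinite ρ ∧ HasBernsteinRepr g a b ρ := by
    obtain ⟨a, b, σ, -, h⟩ := hg
    exact ⟨a, b, _, inferInstance, h⟩
  have hnn : ∀ x, 0 ≤ x → 0 ≤ g x := fun x hx => hrep.nonneg hx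
  have hmono := hrep.monotoneOn
  have hg1 : ∃ s, 0 < s ∧ 0 < g s := by
    obtain ⟨s, hs, hgs⟩ := hg0
    exact ⟨s, hs, lt_of_le_of_ne (hnn s hs.le) hgs.symm⟩
  obtain ⟨κ₀, hκ₀, hpsi⟩ := exists_psiInfty_lower_bound (n := n) hn
  have hn0 : (0 : ℝ) < n := by exact_mod_cast hn
  have hκ : 0 < min κ₀ 1 := lt_min hκ₀ one_pos
  -- The lower bound holds with `κ₀` for $\psi_\infty$ and with `1` for $\mu$, so the minimum serves
  -- both. Dividing by `n` makes $g(s)\ge1/(\gamma t)$ yield the decay exponent `n`.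
  refine ⟨densityConst n, min κ₀ 1 / n, densityConst_pos n, by positivity, ?_⟩
  intro Ω _ P _ X hX hsym
  obtain ⟨j, hjm, hj, hfin, hlow, hchar⟩ : ∃ j : EuclideanSpace ℝ (Fin n) → ℝ≥0∞,
      Measurable j ∧ (∀ y, j (-y) = j y) ∧
      (∀ ξ, ∫⁻ y, ENNReal.ofReal (1 - Real.cos (inner ℝ ξ y)) * j y ≠ ∞) ∧
      (∀ s ξ, 0 < s → s ≤ ‖ξ‖ ^ 2 →
        ENNReal.ofReal (min κ₀ 1 * g s * Real.log (‖ξ‖ ^ 2 / s)) ≤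
          ∫⁻ y, ENNReal.ofReal (1 - Real.cos (inner ℝ ξ y)) * j y) ∧
      HasSymbol P X fun ξ =>
        (∫⁻ y, ENNReal.ofReal (1 - Real.cos (inner ℝ ξ y)) * j y).toReal := by
    have hκlog : ∀ s (ξ : EuclideanSpace ℝ (Fin n)), 0 < s → s ≤ ‖ξ‖ ^ 2 →
        0 ≤ g s ∧ 0 ≤ Real.log (‖ξ‖ ^ 2 / s) := fun s ξ hs hsξ =>
      ⟨hnn s hs.le, Real.log_nonneg ((one_le_div hs).2 hsξ)⟩
    rcases hsym with h | h
    · refine ⟨fun y => ENNReal.ofReal (jumpDensity g y), (measurable_jumpDensity hmono).ennreal_ofReal,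
        fun y => by simp only [jumpDensity_neg], lintegral_cos_mul_jumpDensity_ne_top hnn hν,
        fun s ξ hs hsξ => ?_, ?_⟩
      · obtain ⟨h1, h2⟩ := hκlog s ξ hs hsξ
        refine le_trans (ENNReal.ofReal_le_ofReal ?_) (hpsi g hnn hmono s ξ hs hsξ)
        gcongr
        exact min_le_left _ _
      · simp_rw [← psiInfty_eq_toReal hnn hmono]
        exact h
    · refine ⟨muJumpDensity a b ρ, measurable_muJumpDensity a b ρ, muJumpDensity_neg a b ρ,
        fun ξ => ?_, fun s ξ hs hsξ => ?_, ?_⟩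
      · rw [hrep.lintegral_cos_mul_muJumpDensity]
        exact muENN_ne_top hn hnn hmono hν _
      · rw [hrep.lintegral_cos_mul_muJumpDensity]
        obtain ⟨h1, h2⟩ := hκlog s ξ hs hsξ
        refine le_trans (ENNReal.ofReal_le_ofReal ?_) (muENN_lower_bound hnn hmono hs hsξ)
        rw [mul_assoc]
        exact mul_le_of_le_one_left (mul_nonneg h1 h2) (min_le_right _ _)
      · simp_rw [hrep.lintegral_cos_mul_muJumpDensity]
        simp_rw [← muFun_eq_toReal hnn hmono (sq_nonneg _) (muENN_ne_top hn hnn hmono hν _)]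
        exact h
  have hmain : ∀ t : ℝ≥0, 0 < t → ∃ p : EuclideanSpace ℝ (Fin n) → ℝ, Measurable p ∧
      (∀ x, 0 ≤ p x) ∧ P.map (X t) = volume.withDensity (fun x => ENNReal.ofReal (p x)) ∧
      ∀ x, ENNReal.ofReal (p x) ≤ ENNReal.ofReal (densityConst n) *
        genInv g (1 / (min κ₀ 1 / n * (t : ℝ))) ^ ((n : ℝ) / 2) := by
    intro t ht
    have : IsProbabilityMeasure (P.map (X t)) :=
      Measure.isProbabilityMeasure_map (hX.measurable t).aemeasurable
    exact exists_bounded_density hn hmono hg1 hκ hjm hj hfin hlow (NNReal.coe_pos.2 ht) (hchar t)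
  choose! p hp1 hp2 hp3 hp4 using hmain
  exact ⟨p, fun t ht => ⟨hp1 t ht, hp2 t ht, hp3 t ht⟩, hp4⟩
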